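/- **Setting.** Let $k$ be a commutative ring, $K$ an associative unital (not necessarily commutative) $k$-algebra, $\alpha$ a $k$-algebra endomorphism of $K$, and $B=K[x,\alpha]$ the Ore extension, with $x\lambda=\alpha(\lambda)x$ for $\lambda\in K$. Let $n\ge 2$ and $f=\sum_{i=0}^{n}\lambda_i x^{n-i}\in B$ with $\lambda_0=1$, where $\alpha(\lambda_i)=\lambda_i$ and $\lambda_i\lambda=\alpha^i(\lambda)\lambda_i$ for $1\le i\le n$ and all $\lambda\in K$. Put $A=B/\langle f\rangle$, which is free as a left $K$-module with basis $1,x,\dots,x^{n-1}$. For $P\in B$ let $\overline{P}\in B$ be the unique element such that $P-\overline{P}f$ is $0$ or has degree $<n$; elements of $B$ are also regarded as elements of $A$ via the projection $B\to A$. **The modules.** Let $[A,K]_{\alpha^s}$ be the $k$-submodule of $A$ generated by the elements $a\,\alpha^s(\lambda)-\lambda a$ ($a\in A$, $\lambda\in K$). Put $C^S_{2m}(A)=A/[A,K]_{\alpha^{mn}}$ and $C^S_{2m+1}(A)=A/[A,K]_{\alpha^{mn+1}}$ for $m\ge 0$, and write $[a]$ for the class of $a$. Let $\overline{A}=A/K$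 and, for $r\ge0$, let $H_r=A\otimes_K\overline{A}^{\otimes_K r}\otimes_K$, the quotient of the $K$-bimodule $A\otimes_K\overline{A}^{\otimes_K r}$ by the commutators with elements of $K$. Let $B_r\colon H_r\to H_{r+1}$ be $$B_r([a_0\otimes\cdots\otimes a_r])=\sum_{i=0}^r(-1)^{ir}[1\otimes a_i\otimes\cdots\otimes a_r\otimes a_0\otimes\cdots\otimes a_{i-1}].$$ **The comparison maps.** Let $\phi_r\colon C^S_r(A)\to H_r$ be given by $$\phi_{2m}([a])=\sum_{i,l}[\lambda_{n-i_1}\cdots\lambda_{n-i_m}\,a\,x^{|i-l|-m}\otimes x\otimes x^{l_m}\otimes\cdots\otimes x\otimes x^{l_1}],$$ $$\phi_{2m+1}([a])=\sum_{i,l}[\lambda_{n-i_1}\cdots\lambda_{n-i_m}\,a\,x^{|i-l|-m}\otimes x\otimes x^{l_m}\otimes\cdots\otimes x\otimes x^{l_1}\otimes x],$$ where the sums run over all integers $i_1,\dots,i_m,l_1,\dots,l_m$ with $1\le i_t\le n$ and $1\le l_t<i_t$, and $|i-l|=\sum_t(i_t-l_t)$. Let $\psi_r\colon H_r\to C^S_r(A)$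 be the $k$-linear map determined, for $a\in A$ and $0\le i_t<n$, by $$\psi_{2m}([a\otimes x^{i_1}\otimes\cdots\otimes x^{i_{2m}}])=[a\,\overline{x^{i_1+i_2}}\cdots\overline{x^{i_{2m-1}+i_{2m}}}],$$ $$\psi_{2m+1}([a\otimes x^{i_1}\otimes\cdots\otimes x^{i_{2m+1}}])=\sum_{\ell=0}^{i_{2m+1}-1}[x^{i_{2m+1}-\ell-1}\,a\,\overline{x^{i_1+i_2}}\cdots\overline{x^{i_{2m-1}+i_{2m}}}\,x^{\ell}].$$ These maps are well defined. The Connes operator of $C^S(A)$ is $D_r=\psi_{r+1}\circ B_r\circ\phi_r\colon C^S_r(A)\to C^S_{r+1}(A)$. **Theorem 3.3.** For all $m\ge0$, $0\le j<n$ and $\lambda\in K$, $$D_{2m}([\lambda x^j])=\Bigl[\sum_{h=0}^{j-1}\alpha^{mn+h}(\lambda)\,x^{j-1}\Bigr]+\sum_{u=0}^{m-1}\Bigl[\,\overline{\sum_{i=1}^{n}\lambda_{n-i}\Bigl(\sum_{l=0}^{i-1}\alpha^{nu+l}(\lambda)\Bigr)x^{j+i-1}}\,\Bigr],$$ $$D_{2m+1}([\lambda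 x^j])=\begin{cases}0&\text{if } j<n-1,\\ \Bigl[(\mathrm{id}-\alpha)\Bigl(\sum_{u=0}^{m}\alpha^{nu}(\lambda)\Bigr)\Bigr]&\text{if } j=n-1.\end{cases}$$ -/

import Mathlib

open scoped TensorProduct

noncomputable section

universe u v

/-- The data of a noncommutative monogenic extension of a `k`-algebra `K`: an endomorphism `α`, a
degree `n ≥ 2` and the coefficients `lam i` (`0 ≤ i ≤ n`, with `lam 0 = 1`) of the monic polynomial
`f = ∑_{i=0}^n lam i * x^(n-i)`.  The values `lam i` for `i > n` are never used. -/
structure MonogenicDatum (k : Type u) (K : Type v) [CommRing k] [Ring K] [Algebra k K] where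
  α : K →ₐ[k] K
  n : ℕ
  two_le : 2 ≤ n
  lam : ℕ → K
  lam_zero : lam 0 = 1
  α_lam : ∀ i, 1 ≤ i → i ≤ n → α (lam i) = lam i
  lam_mul : ∀ i, 1 ≤ i → i ≤ n → ∀ c : K, lam i * c = (α ^ i) c * lam i

namespace MonogenicDatum

variable {k : Type u} {K : Type v} [CommRing k] [Ring K] [Algebra k K] (E : MonogenicDatum k K)

/-! ### The Ore extension `B = K[x, α]` -/

/-- The action of `Multiplicative ℕ` on `K` by the powers of `α`. -/
@[reducible] def oreAction : MulSemiringAction (Multiplicative ℕ) K :=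
  MulSemiringAction.compHom K
    (powersHom (K →+* K) (E.α : K →+* K))

/-- The Ore extension `K[x, α]`: skew polynomials with `x * c = α c * x`. -/
def Ore (_E : MonogenicDatum k K) : Type v := SkewPolynomial K

/-- The ring structure of `K[x, α]`. -/
def oreRing : Ring E.Ore :=
  @SkewMonoidAlgebra.instRing K (Multiplicative ℕ) _ _ E.oreAction

instance : Ring E.Ore := E.oreRing

theorem oreAction_smul (i : ℕ) (c : K) :
    (E.oreAction.toSMul.smul (Multiplicative.ofAdd i) c) = (E.α ^ i) c := by
  induction i generalizing c with
  | zero =>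
    change ((powersHom (K →+* K) (E.α : K →+* K)) (Multiplicative.ofAdd 0)) c = _
    simp
  | succ i ih =>
    have h1 := ih (E.α c)
    change ((powersHom (K →+* K) (E.α : K →+* K)) (Multiplicative.ofAdd i)) _ = _ at h1
    change ((powersHom (K →+* K) (E.α : K →+* K)) (Multiplicative.ofAdd (i + 1))) c = _
    rw [pow_succ, AlgHom.mul_apply, ← h1, powersHom_apply, powersHom_apply]
    simp [pow_succ]

theorem oreAction_smulComm :
    @SMulCommClass (Multiplicative ℕ) k K E.oreAction.toSMul _ :=
  @SMulCommClass.mk _ _ _ E.oreAction.toSMul _ fun m r c => by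
    have h := fun c => E.oreAction_smul m.toAdd c
    calc _ = (E.α ^ m.toAdd) (r • c) := h _
      _ = r • (E.α ^ m.toAdd) c := map_smul _ _ _
      _ = _ := congrArg (r • ·) (h c).symm

/-- The `k`-algebra structure of `K[x, α]`. -/
def oreAlgebra : Algebra k E.Ore :=
  @SkewMonoidAlgebra.instAlgebraOfSMulCommClass k (Multiplicative ℕ) _ _ K _ _ E.oreAction
    E.oreAction_smulComm

instance : Algebra k E.Ore := E.oreAlgebra

/-- The inclusion of the coefficient ring `K` in `K[x, α]`. -/
def C : K →ₐ[k] E.Ore :=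
  letI := E.oreAction
  { (SkewPolynomial.CRingHom : K →+* SkewPolynomial K) with
    commutes' := fun _ => rfl }

/-- The variable `x` of `K[x, α]`. -/
def X : E.Ore := (SkewPolynomial.X : SkewPolynomial K)

/-- `E.coeff P i` is the (left) coefficient of `x ^ i` in `P`. -/
def coeff (P : E.Ore) (i : ℕ) : K := SkewPolynomial.coeff (R := K) P i

theorem C_mul_X_pow_mul (a b : K) (i j : ℕ) :
    (E.C a * E.X ^ i) * (E.C b * E.X ^ j) = E.C (a * (E.α ^ i) b) * E.X ^ (i + j) := by
  let _ := E.oreAction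
  have h := SkewPolynomial.monomial_mul_monomial i j a b
  rw [SkewPolynomial.φ_iterate_apply] at h
  have h2 : (Multiplicative.ofAdd i) • b = (E.α ^ i) b := E.oreAction_smul i b
  rw [h2] at h
  simp only [← SkewPolynomial.C_mul_X_pow_eq_monomial] at h
  exact h

theorem X_pow_mul_C (i : ℕ) (c : K) : E.X ^ i * E.C c = E.C ((E.α ^ i) c) * E.X ^ i := by
  simpa using E.C_mul_X_pow_mul 1 c i 0

theorem coeff_add (P Q : E.Ore) (i : ℕ) : E.coeff (P + Q) i = E.coeff P i + E.coeff Q i :=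
  congrFun (congrArg DFunLike.coe (SkewMonoidAlgebra.coeff_add (k := K) P Q)) (Multiplicative.ofAdd i)

theorem coeff_C_mul_X_pow (a : K) (i j : ℕ) :
    E.coeff (E.C a * E.X ^ i) j = if i = j then a else 0 := by
  let _ := E.oreAction
  have h := SkewPolynomial.coeff_monomial (n := i) (m := j) (a := a)
  rw [← SkewPolynomial.C_mul_X_pow_eq_monomial] at h
  exact h

/-- The coefficient of `x ^ i` as an additive map. -/
def coeffHom (i : ℕ) : E.Ore →+ K where
  toFun P := E.coeff P i
  map_zero' := rfl
  map_add' P Q := E.coeff_add P Q i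

theorem coeffHom_apply (i : ℕ) (P : E.Ore) : E.coeffHom i P = E.coeff P i := rfl

theorem ore_ext {P Q : E.Ore} (h : ∀ i, E.coeff P i = E.coeff Q i) : P = Q :=
  SkewPolynomial.ext (R := K) h

theorem ore_induction {p : E.Ore → Prop} (P : E.Ore) (h0 : p 0)
    (ha : ∀ P Q, p P → p Q → p (P + Q)) (hm : ∀ a i, p (E.C a * E.X ^ i)) : p P := by
  let _ := E.oreAction
  refine SkewPolynomial.induction (R := K) (motive := p) P h0 (fun i a Q _ _ hQ => ?_)
  have := hm a i
  refine ha _ _ ?_ hQ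
  have h := SkewPolynomial.C_mul_X_pow_eq_monomial (n := i) (a := a)
  rw [← h]
  exact this

theorem coeff_C_mul (a : K) (P : E.Ore) (i : ℕ) : E.coeff (E.C a * P) i = a * E.coeff P i := by
  simp only [← coeffHom_apply]
  induction P using E.ore_induction with
  | h0 => simp
  | ha P Q hP hQ => simp [mul_add, hP, hQ]
  | hm b j => 
    rw [← mul_assoc, ← map_mul]
    simp only [coeffHom_apply, coeff_C_mul_X_pow]
    split_ifs <;> simp

theorem coeff_mul_C (a : K) (P : E.Ore) (i : ℕ) :
    E.coeff (P * E.C a) i = E.coeff P i * (E.α ^ i) a := by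
  simp only [← coeffHom_apply]
  induction P using E.ore_induction with
  | h0 => simp
  | ha P Q hP hQ => simp [add_mul, hP, hQ]
  | hm b j => 
    rw [mul_assoc, X_pow_mul_C, ← mul_assoc, ← map_mul]
    simp only [coeffHom_apply, coeff_C_mul_X_pow]
    split_ifs with h
    · rw [h]
    · simp

/-! ### The polynomial `f` and division by it -/

/-- The monic polynomial `f = ∑_{i=0}^n lam i * x^(n-i)`. -/
def f : E.Ore := ∑ i ∈ Finset.range (E.n + 1), E.C (E.lam i) * E.X ^ (E.n - i)

/-- `P = 0` or `deg P < n`. -/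
def IsLow (P : E.Ore) : Prop := ∀ i, E.n ≤ i → E.coeff P i = 0

variable {E} in
theorem IsLow.add {P Q : E.Ore} (hP : E.IsLow P) (hQ : E.IsLow Q) : E.IsLow (P + Q) :=
  fun i hi => by rw [coeff_add, hP i hi, hQ i hi, add_zero]

theorem isLow_zero : E.IsLow 0 := fun _ _ => rfl

variable {E} in
theorem IsLow.neg {P : E.Ore} (hP : E.IsLow P) : E.IsLow (-P) :=
  fun i hi => by rw [← coeffHom_apply, map_neg, coeffHom_apply, hP i hi, neg_zero]

variable {E} in
theorem IsLow.C_mul {P : E.Ore} (hP : E.IsLow P) (c : K) : E.IsLow (E.C c * P) :=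
  fun i hi => by rw [coeff_C_mul, hP i hi, mul_zero]

variable {E} in
theorem IsLow.mul_C {P : E.Ore} (hP : E.IsLow P) (c : K) : E.IsLow (P * E.C c) :=
  fun i hi => by rw [coeff_mul_C, hP i hi, zero_mul]

theorem isLow_monomial (c : K) {i : ℕ} (hi : i < E.n) : E.IsLow (E.C c * E.X ^ i) :=
  fun j hj => by rw [coeff_C_mul_X_pow, if_neg (by omega)]

theorem isLow_X_pow {i : ℕ} (hi : i < E.n) : E.IsLow (E.X ^ i) := by
  simpa using E.isLow_monomial 1 hi

theorem isLow_C (c : K) : E.IsLow (E.C c) := by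
  have := E.two_le
  simpa using E.isLow_monomial c (i := 0) (by omega)

theorem f_mul_C (c : K) : E.f * E.C c = E.C ((E.α ^ E.n) c) * E.f := by
  rw [f, Finset.sum_mul, Finset.mul_sum]
  refine Finset.sum_congr rfl fun i hi => ?_
  have hi' : i ≤ E.n := by simpa [Nat.lt_succ_iff] using hi
  rw [mul_assoc, X_pow_mul_C, ← mul_assoc, ← mul_assoc, ← map_mul, ← map_mul]
  congr 2
  rcases Nat.eq_zero_or_pos i with rfl | h
  · simp [E.lam_zero]
  · rw [E.lam_mul i h hi', ← AlgHom.mul_apply, ← pow_add, Nat.add_sub_cancel' hi']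

theorem f_mul_X : E.f * E.X = E.X * E.f := by
  rw [f, Finset.sum_mul, Finset.mul_sum]
  refine Finset.sum_congr rfl fun i hi => ?_
  have hi' : i ≤ E.n := by simpa [Nat.lt_succ_iff] using hi
  have h : E.X * E.C (E.lam i) = E.C (E.lam i) * E.X := by
    have := E.X_pow_mul_C 1 (E.lam i)
    rcases Nat.eq_zero_or_pos i with rfl | h
    · simp [E.lam_zero]
    · simpa [E.α_lam i h hi'] using this
  rw [← mul_assoc, h, mul_assoc, mul_assoc, pow_mul_comm']

theorem f_mul_X_pow (i : ℕ) : E.f * E.X ^ i = E.X ^ i * E.f := by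
  have : Commute E.f E.X := E.f_mul_X
  exact this.pow_right i

theorem f_eq : ∃ g, E.IsLow g ∧ E.f = E.X ^ E.n + g := by
  refine ⟨∑ i ∈ Finset.range E.n, E.C (E.lam (i + 1)) * E.X ^ (E.n - (i + 1)), ?_, ?_⟩
  · intro j hj
    rw [← coeffHom_apply, map_sum]
    refine Finset.sum_eq_zero fun i hi => ?_
    have := Finset.mem_range.1 hi
    exact E.isLow_monomial _ (by omega) j hj
  · rw [f, Finset.sum_range_succ', E.lam_zero, add_comm]
    simp

theorem exists_mul_f (P : E.Ore) : ∃ Q, E.f * P = Q * E.f := by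
  induction P using E.ore_induction with
  | h0 => exact ⟨0, by simp⟩
  | ha P Q hP hQ =>
    obtain ⟨P', hP⟩ := hP
    obtain ⟨Q', hQ⟩ := hQ
    exact ⟨P' + Q', by rw [mul_add, hP, hQ, add_mul]⟩
  | hm a i =>
    refine ⟨E.C ((E.α ^ E.n) a) * E.X ^ i, ?_⟩
    rw [← mul_assoc, f_mul_C, mul_assoc, f_mul_X_pow, mul_assoc]

/-- Existence in the division by `f`. -/
theorem exists_div (P : E.Ore) : ∃ Q, E.IsLow (P - Q * E.f) := by
  induction P using E.ore_induction with
  | h0 => exact ⟨0, by simpa using E.isLow_zero⟩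
  | ha P Q hP hQ =>
    obtain ⟨P', hP⟩ := hP
    obtain ⟨Q', hQ⟩ := hQ
    refine ⟨P' + Q', ?_⟩
    have := hP.add hQ
    rwa [show P + Q - (P' + Q') * E.f = P - P' * E.f + (Q - Q' * E.f) by noncomm_ring]
  | hm a i =>
    suffices h : ∃ Q, E.IsLow (E.X ^ i - Q * E.f) by
      obtain ⟨Q, hQ⟩ := h
      refine ⟨E.C a * Q, ?_⟩
      have := hQ.C_mul a
      rwa [mul_sub, ← mul_assoc] at this
    clear a
    induction i with
    | zero =>
      have := E.two_le
      exact ⟨0, by simpa using E.isLow_X_pow (i := 0) (by omega)⟩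
    | succ i ih =>
      obtain ⟨Q, hQ⟩ := ih
      obtain ⟨g, hg, hf⟩ := E.f_eq
      set R := E.X ^ i - Q * E.f with hR
      have h2 := E.two_le
      refine ⟨Q * E.X + E.C (E.coeff R (E.n - 1)), ?_⟩
      have e : E.X ^ (i + 1) - (Q * E.X + E.C (E.coeff R (E.n - 1))) * E.f =
          (R * E.X - E.C (E.coeff R (E.n - 1)) * E.X ^ E.n)
            + -(E.C (E.coeff R (E.n - 1)) * g) := by
        have h3 : R * E.X = E.X ^ (i + 1) - Q * E.X * E.f := by
          rw [hR, sub_mul, pow_succ, mul_assoc Q, mul_assoc Q, f_mul_X]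
        rw [h3, add_mul]
        have h4 : E.C (E.coeff R (E.n - 1)) * E.f = E.C (E.coeff R (E.n - 1)) * E.X ^ E.n +
            E.C (E.coeff R (E.n - 1)) * g := by rw [hf, mul_add]
        rw [h4]
        abel
      rw [e]
      refine IsLow.add ?_ (hg.C_mul _).neg
      have key : ∀ P : E.Ore, ∀ j, E.coeff (P * E.X) (j + 1) = E.coeff P j := by
        intro P j
        simp only [← coeffHom_apply]
        induction P using E.ore_induction with
        | h0 => simp
        | ha P Q hP hQ => rw [add_mul, map_add, map_add, hP, hQ]
        | hm b l =>
          rw [mul_assoc, ← pow_succ]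
          simp [coeffHom_apply, coeff_C_mul_X_pow]
      intro j hj
      rw [← coeffHom_apply, map_sub, coeffHom_apply, coeffHom_apply, coeff_C_mul_X_pow]
      obtain ⟨j, rfl⟩ : ∃ l, j = l + 1 := ⟨j - 1, by omega⟩
      rw [key]
      split_ifs with h
      · rw [h, Nat.add_sub_cancel, sub_self]
      · rw [hQ j (by omega), sub_zero]

/-- Uniqueness in the division by `f`. -/
theorem eq_zero_of_isLow_mul_f {Q : E.Ore} (h : E.IsLow (Q * E.f)) : Q = 0 := by
  obtain ⟨g, hg, hf⟩ := E.f_eq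
  -- the coefficients of a product with a low polynomial
  have h1 : ∀ (R : E.Ore), E.IsLow R → ∀ (a : K) (i j : ℕ), E.n + i ≤ j →
      E.coeff (E.C a * E.X ^ i * R) j = 0 := by
    intro R hR a i j hj
    have : ∀ R : E.Ore, E.coeff (E.C a * E.X ^ i * R) j = a * (E.α ^ i) (E.coeff R (j - i)) := by
      intro R
      simp only [← coeffHom_apply]
      induction R using E.ore_induction with
      | h0 => simp
      | ha P Q hP hQ => simp [mul_add, hP, hQ]
      | hm b l =>
        rw [C_mul_X_pow_mul]
        simp only [coeffHom_apply, coeff_C_mul_X_pow]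
        by_cases h : l = j - i
        · rw [if_pos h, if_pos (by omega)]
        · rw [if_neg h, if_neg (by omega)]; simp
    rw [this, hR _ (by omega)]; simp
  obtain ⟨N, hN⟩ : ∃ N, ∀ i, N ≤ i → E.coeff Q i = 0 := by
    clear h
    induction Q using E.ore_induction with
    | h0 => exact ⟨0, fun _ _ => rfl⟩
    | ha P Q hP hQ =>
      obtain ⟨a, ha⟩ := hP
      obtain ⟨b, hb⟩ := hQ
      exact ⟨max a b, fun i hi => by rw [coeff_add, ha i (by omega), hb i (by omega), add_zero]⟩
    | hm a i => exact ⟨i + 1, fun j hj => by rw [coeff_C_mul_X_pow, if_neg (by omega)]⟩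
  have hsum : ∀ N (Q : E.Ore), (∀ i, N ≤ i → E.coeff Q i = 0) →
      Q = ∑ i ∈ Finset.range N, E.C (E.coeff Q i) * E.X ^ i := by
    intro N Q hN
    refine E.ore_ext fun i => ?_
    rw [← E.coeffHom_apply i (∑ i ∈ Finset.range N, E.C (E.coeff Q i) * E.X ^ i), map_sum]
    simp only [coeffHom_apply, coeff_C_mul_X_pow, Finset.sum_ite_eq', Finset.mem_range]
    split_ifs with hi
    · rfl
    · exact hN i (by omega)
  induction N with
  | zero => exact E.ore_ext fun i => hN i (Nat.zero_le _)
  | succ N ih =>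
    apply ih
    intro i hi
    rcases Nat.lt_or_ge N i with hi' | hi'
    · exact hN i hi'
    · obtain rfl : i = N := by omega
      have e := h (i + E.n) (by omega)
      rw [hf, mul_add, coeff_add, hsum _ Q hN, Finset.sum_mul, Finset.sum_mul,
        ← coeffHom_apply, ← coeffHom_apply, map_sum, map_sum, Finset.sum_eq_zero
          (s := Finset.range (i + 1)) (f := fun x => (E.coeffHom (i + E.n))
            (E.C (E.coeff Q x) * E.X ^ x * g))
          (fun j hj => h1 g hg _ j _ (by have := Finset.mem_range.1 hj; omega)), add_zero] at e
      simp only [mul_assoc, ← pow_add, coeffHom_apply, coeff_C_mul_X_pow] at e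
      simpa using e

theorem div_unique {P Q Q' : E.Ore} (h : E.IsLow (P - Q * E.f)) (h' : E.IsLow (P - Q' * E.f)) :
    Q = Q' := by
  refine sub_eq_zero.1 (E.eq_zero_of_isLow_mul_f ?_)
  have := h'.add h.neg
  rwa [show P - Q' * E.f + -(P - Q * E.f) = (Q - Q') * E.f by noncomm_ring] at this

/-- The quotient `P̄` of the division `P = P̄ * f + R`, `deg R < n`. -/
def quo (P : E.Ore) : E.Ore := Classical.choose (E.exists_div P)

theorem quo_spec (P : E.Ore) : E.IsLow (P - E.quo P * E.f) := Classical.choose_spec (E.exists_div P)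

theorem quo_eq {P Q : E.Ore} (h : E.IsLow (P - Q * E.f)) : E.quo P = Q :=
  E.div_unique (E.quo_spec P) h

/-! ### The monogenic extension `A = B / ⟨f⟩` -/

/-- The monogenic extension `A = K[x, α] / ⟨f⟩` (quotient by the two-sided ideal generated
by `f`). -/
def A : Type v := (TwoSidedIdeal.span {E.f}).ringCon.Quotient

/-- The ring structure of `A`. -/
def ringA : Ring E.A := inferInstanceAs (Ring (TwoSidedIdeal.span {E.f}).ringCon.Quotient)

instance : Ring E.A := E.ringA

/-- The `k`-algebra structure of `A`. -/
def algebraA : Algebra k E.A :=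
  inferInstanceAs (Algebra k (TwoSidedIdeal.span {E.f}).ringCon.Quotient)

instance : Algebra k E.A := E.algebraA

/-- The canonical projection `B → A`. -/
def toA : E.Ore →ₐ[k] E.A :=
  { (TwoSidedIdeal.span {E.f}).ringCon.mk' with
    commutes' := fun _ => rfl }

/-- The inclusion `K → A`. -/
def incl : K →ₐ[k] E.A := E.toA.comp E.C

/-- The class of `x` in `A`. -/
def x : E.A := E.toA E.X

theorem toA_surjective : Function.Surjective E.toA :=
  RingCon.mk'_surjective (TwoSidedIdeal.span {E.f}).ringCon

theorem toA_eq_zero (P : E.Ore) : E.toA P = 0 ↔ ∃ Q, P = Q * E.f := by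
  have h1 : E.toA P = 0 ↔ P ∈ TwoSidedIdeal.span {E.f} := by
    rw [TwoSidedIdeal.mem_iff]
    exact RingCon.eq (TwoSidedIdeal.span {E.f}).ringCon
  rw [h1]
  constructor
  · intro h
    let I : TwoSidedIdeal E.Ore := TwoSidedIdeal.mk' {P | ∃ Q, P = Q * E.f} ⟨0, by simp⟩
      (by rintro _ _ ⟨a, rfl⟩ ⟨b, rfl⟩; exact ⟨a + b, by rw [add_mul]⟩)
      (by rintro _ ⟨a, rfl⟩; exact ⟨-a, by rw [neg_mul]⟩)
      (by rintro c _ ⟨a, rfl⟩; exact ⟨c * a, by rw [mul_assoc]⟩)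
      (by
        rintro _ c ⟨a, rfl⟩
        obtain ⟨d, hd⟩ := E.exists_mul_f c
        exact ⟨a * d, by rw [mul_assoc, hd, mul_assoc]⟩)
    have h2 : TwoSidedIdeal.span {E.f} ≤ I := by
      rw [TwoSidedIdeal.span_le]
      rintro _ rfl
      exact (TwoSidedIdeal.mem_mk' {P | ∃ Q, P = Q * E.f} _ _ _ _ _ _).2 ⟨1, by simp⟩
    exact (TwoSidedIdeal.mem_mk' {P | ∃ Q, P = Q * E.f} _ _ _ _ _ _).1 (h2 h)
  · rintro ⟨Q, rfl⟩
    exact TwoSidedIdeal.mul_mem_left _ _ _ (TwoSidedIdeal.subset_span rfl)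

theorem x_pow_mul_incl (i : ℕ) (c : K) : E.x ^ i * E.incl c = E.incl ((E.α ^ i) c) * E.x ^ i := by
  have := congrArg E.toA (E.X_pow_mul_C i c)
  simpa [x, incl] using this

theorem exists_low (a : E.A) : ∃ P, E.IsLow P ∧ E.toA P = a := by
  obtain ⟨P, rfl⟩ := E.toA_surjective a
  refine ⟨P - E.quo P * E.f, E.quo_spec P, ?_⟩
  rw [map_sub, (E.toA_eq_zero _).2 ⟨_, rfl⟩, sub_zero]

theorem low_unique {P Q : E.Ore} (hP : E.IsLow P) (hQ : E.IsLow Q) (h : E.toA P = E.toA Q) :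
    P = Q := by
  rw [← sub_eq_zero, ← map_sub, toA_eq_zero] at h
  obtain ⟨R, hR⟩ := h
  have : R = 0 := E.eq_zero_of_isLow_mul_f (by rw [← hR, sub_eq_add_neg]; exact hP.add hQ.neg)
  rw [this, zero_mul] at hR
  exact sub_eq_zero.1 hR

/-- The representative of degree `< n` of an element of `A`. -/
def low (a : E.A) : E.Ore := Classical.choose (E.exists_low a)

theorem low_isLow (a : E.A) : E.IsLow (E.low a) := (Classical.choose_spec (E.exists_low a)).1

theorem toA_low (a : E.A) : E.toA (E.low a) = a := (Classical.choose_spec (E.exists_low a)).2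

theorem low_mk {P : E.Ore} (h : E.IsLow P) : E.low (E.toA P) = P :=
  E.low_unique (E.low_isLow _) h (E.toA_low _)

theorem low_add (a b : E.A) : E.low (a + b) = E.low a + E.low b :=
  E.low_unique (E.low_isLow _) ((E.low_isLow _).add (E.low_isLow _)) (by simp [toA_low])

theorem low_incl_mul (c : K) (a : E.A) : E.low (E.incl c * a) = E.C c * E.low a :=
  E.low_unique (E.low_isLow _) ((E.low_isLow _).C_mul _) (by simp [toA_low, incl])

theorem low_mul_incl (c : K) (a : E.A) : E.low (a * E.incl c) = E.low a * E.C c :=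
  E.low_unique (E.low_isLow _) ((E.low_isLow _).mul_C _) (by simp [toA_low, incl])

/-- The coordinates in the left `K`-basis `1, x, …, x ^ (n - 1)` of `A`. -/
def coord (i : ℕ) : E.A →ₗ[k] K where
  toFun a := E.coeff (E.low a) i
  map_add' a b := by rw [low_add, coeff_add]
  map_smul' r a := by
    have : r • a = E.incl (algebraMap k K r) * a := by
      rw [Algebra.smul_def, AlgHom.commutes]
    rw [this, low_incl_mul, coeff_C_mul, RingHom.id_apply, Algebra.smul_def]

theorem coord_incl_mul (i : ℕ) (c : K) (a : E.A) :
    E.coord i (E.incl c * a) = c * E.coord i a := by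
  change E.coeff (E.low (E.incl c * a)) i = _
  rw [low_incl_mul, coeff_C_mul]; rfl

theorem coord_mul_incl (i : ℕ) (c : K) (a : E.A) :
    E.coord i (a * E.incl c) = E.coord i a * (E.α ^ i) c := by
  change E.coeff (E.low (a * E.incl c)) i = _
  rw [low_mul_incl, coeff_mul_C]; rfl

theorem coord_incl_of_ne_zero {i : ℕ} (hi : i ≠ 0) (c : K) : E.coord i (E.incl c) = 0 := by
  change E.coeff (E.low (E.toA (E.C c))) i = _
  rw [low_mk _ (E.isLow_C c)]
  simpa [hi.symm] using E.coeff_C_mul_X_pow c 0 i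

/-! ### The modules `C^S_r(A)` -/

/-- The twisting exponent in degree `r`: `m * n` if `r = 2 * m`, and `m * n + 1` if
`r = 2 * m + 1`. -/
def twist (r : ℕ) : ℕ := r / 2 * E.n + r % 2

/-- `[A, K]_{α ^ s}`, the `k`-submodule generated by the `a * α ^ s c - c * a`. -/
def twistedComm (s : ℕ) : Submodule k E.A :=
  Submodule.span k
    {a | ∃ (b : E.A) (c : K), a = b * E.incl ((E.α ^ s) c) - E.incl c * b}

/-- `C^S_r(A) = A / [A, K]_{α ^ (twist r)}`. -/
abbrev CS (r : ℕ) : Type v := E.A ⧸ E.twistedComm (E.twist r)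

/-- The class `[a]` of `a ∈ A` in `C^S_r(A)`. -/
def cls (r : ℕ) : E.A →ₗ[k] E.CS r := (E.twistedComm (E.twist r)).mkQ

theorem cls_twist (r : ℕ) (b : E.A) (c : K) :
    E.cls r (b * E.incl ((E.α ^ E.twist r) c)) = E.cls r (E.incl c * b) :=
  (Submodule.Quotient.eq _).2 (Submodule.subset_span ⟨b, c, rfl⟩)

/-! ### The normalized Hochschild complex relative to `K`, and its operator `B` -/

/-- The relations which present `A ⊗_K Ā^{⊗_K r} ⊗_K` (with `Ā = A / K`) as a quotient of the tensor
power `A^{⊗_k (r + 1)}`: a tensor with a factor in `K` at a position `p ≠ 0` vanishes, and scalars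
in `K` can be moved between consecutive factors, the last factor being followed by the first. -/
def hochRel (r : ℕ) : Submodule k (⨂[k] _ : Fin (r + 1), E.A) :=
  Submodule.span k
    ({t | ∃ (a : Fin (r + 1) → E.A) (p : Fin (r + 1)) (c : K),
        p ≠ 0 ∧ a p = E.incl c ∧ t = PiTensorProduct.tprod k a} ∪
     {t | ∃ (a : Fin (r + 1) → E.A) (p : Fin (r + 1)) (c : K),
        t = PiTensorProduct.tprod k (Function.update a p (a p * E.incl c)) -
          PiTensorProduct.tprod k (Function.update a (p + 1) (E.incl c * a (p + 1)))})

/-- `A ⊗_K Ā^{⊗_K r} ⊗_K`, the degree `r` part of the normalized Hochschild complex of `A`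
relative to `K`. -/
abbrev Hoch (r : ℕ) : Type (max u v) := (⨂[k] _ : Fin (r + 1), E.A) ⧸ E.hochRel r

/-- The class `[a 0 ⊗ ⋯ ⊗ a r]`. -/
def hcls (r : ℕ) : MultilinearMap k (fun _ : Fin (r + 1) => E.A) (E.Hoch r) :=
  (E.hochRel r).mkQ.compMultilinearMap (PiTensorProduct.tprod k)

theorem hcls_eq_zero {r : ℕ} {a : Fin (r + 1) → E.A} {p : Fin (r + 1)} (hp : p ≠ 0) {c : K}
    (h : a p = E.incl c) : E.hcls r a = 0 :=
  (Submodule.Quotient.mk_eq_zero _).2 (Submodule.subset_span (Or.inl ⟨a, p, c, hp, h, rfl⟩))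

theorem hcls_balance {r : ℕ} (a : Fin (r + 1) → E.A) (p : Fin (r + 1)) (c : K) :
    E.hcls r (Function.update a p (a p * E.incl c)) =
      E.hcls r (Function.update a (p + 1) (E.incl c * a (p + 1))) :=
  (Submodule.Quotient.eq _).2 (Submodule.subset_span (Or.inr ⟨a, p, c, rfl⟩))

theorem hochRel_le {M : Type*} [AddCommGroup M] [Module k M] (r : ℕ)
    (g : MultilinearMap k (fun _ : Fin (r + 1) => E.A) M)
    (h0 : ∀ (a : Fin (r + 1) → E.A) (p : Fin (r + 1)) (c : K),
      p ≠ 0 → a p = E.incl c → g a = 0)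
    (h1 : ∀ (a : Fin (r + 1) → E.A) (p : Fin (r + 1)) (c : K),
      g (Function.update a p (a p * E.incl c)) =
        g (Function.update a (p + 1) (E.incl c * a (p + 1)))) :
    E.hochRel r ≤ (PiTensorProduct.lift g).ker := by
  refine Submodule.span_le.2 ?_
  rintro _ (⟨a, p, c, hp, h, rfl⟩ | ⟨a, p, c, rfl⟩)
  · simpa using h0 a p c hp h
  · simpa [sub_eq_zero] using h1 a p c

/-- A multilinear map compatible with the relations factors through `Hoch r`. -/
def hochLift {M : Type*} [AddCommGroup M] [Module k M] (r : ℕ)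
    (g : MultilinearMap k (fun _ : Fin (r + 1) => E.A) M)
    (h0 : ∀ (a : Fin (r + 1) → E.A) (p : Fin (r + 1)) (c : K),
      p ≠ 0 → a p = E.incl c → g a = 0)
    (h1 : ∀ (a : Fin (r + 1) → E.A) (p : Fin (r + 1)) (c : K),
      g (Function.update a p (a p * E.incl c)) =
        g (Function.update a (p + 1) (E.incl c * a (p + 1)))) :
    E.Hoch r →ₗ[k] M :=
  (E.hochRel r).liftQ (PiTensorProduct.lift g) (E.hochRel_le r g h0 h1)

theorem hochLift_hcls {M : Type*} [AddCommGroup M] [Module k M] (r : ℕ)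
    (g : MultilinearMap k (fun _ : Fin (r + 1) => E.A) M) (h0) (h1) (a : Fin (r + 1) → E.A) :
    E.hochLift r g h0 h1 (E.hcls r a) = g a := by
  change (E.hochRel r).liftQ (PiTensorProduct.lift g) _
    (Submodule.Quotient.mk (PiTensorProduct.tprod k a)) = _
  rw [Submodule.liftQ_apply, PiTensorProduct.lift.tprod]

/-- `a ↦ [1 ⊗ a i ⊗ ⋯ ⊗ a r ⊗ a 0 ⊗ ⋯ ⊗ a (i - 1)]` (the indices `i + j` are taken modulo
`r + 1`). -/
def rotOne (r : ℕ) (i : Fin (r + 1)) :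
    MultilinearMap k (fun _ : Fin (r + 1) => E.A) (E.Hoch (r + 1)) :=
  ((E.hcls (r + 1)).curryLeft 1).domDomCongr (Equiv.addLeft i)

theorem rotOne_apply (r : ℕ) (i : Fin (r + 1)) (a : Fin (r + 1) → E.A) :
    E.rotOne r i a = E.hcls (r + 1) (Fin.cons 1 fun j => a (i + j)) := rfl

theorem rotOne_balance (r : ℕ) (i : Fin (r + 1)) (a : Fin (r + 1) → E.A) (p : Fin (r + 1)) (c : K) :
    E.rotOne r i (Function.update a p (a p * E.incl c)) =
      E.rotOne r i (Function.update a (p + 1) (E.incl c * a (p + 1))) := by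
  have hu : ∀ (q : Fin (r + 1)) (y : E.A), (fun j => Function.update a q y (i + j)) =
      Function.update (fun j => a (i + j)) (q - i) y := by
    intro q y
    funext j
    by_cases h : j = q - i
    · subst h; simp
    · rw [Function.update_of_ne h, Function.update_of_ne]
      intro h'; apply h; rw [← h']; simp
  rw [rotOne_apply, rotOne_apply, hu, hu, show p + 1 - i = (p - i) + 1 by abel]
  set b : Fin (r + 1) → E.A := fun j => a (i + j) with hb
  have h1 : a p = b (p - i) := by simp [hb]
  have h2 : a (p + 1) = b (p - i + 1) := by
    simp only [hb]; congr 1; abel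
  rw [h1, h2]
  generalize p - i = j
  clear_value b
  simp only [Fin.cons_update]
  have key := E.hcls_balance (Fin.cons 1 b : Fin (r + 2) → E.A)
  induction j using Fin.lastCases with
  | last =>
    have k1 := key (Fin.last (r + 1)) c
    have k2 := key 0 c
    rw [Fin.last_add_one] at k1
    rw [← Fin.succ_last] at k1
    simp only [Fin.cons_succ, Fin.cons_zero, mul_one, one_mul] at k1 k2
    rw [Fin.last_add_one]
    rw [k1, k2]
    rfl
  | cast j =>
    have k1 := key j.castSucc.succ c
    rw [Fin.succ_castSucc, Fin.coeSucc_eq_succ] at k1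
    rw [Fin.succ_castSucc, Fin.coeSucc_eq_succ]
    simpa only [Fin.cons_succ, ← Fin.succ_castSucc] using k1

/-- The operator `B [a 0 ⊗ ⋯ ⊗ a r] = ∑_{i=0}^r (-1)^(i r) [1 ⊗ a i ⊗ ⋯ ⊗ a r ⊗ a 0 ⊗ ⋯ ⊗ a (i-1)]`
of the normalized mixed complex of `A` relative to `K`. -/
def B (r : ℕ) : E.Hoch r →ₗ[k] E.Hoch (r + 1) :=
  E.hochLift r (∑ i : Fin (r + 1), (-1 : k) ^ (i.val * r) • E.rotOne r i)
    (fun a p c _ h => by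
      rw [sum_apply]
      refine Finset.sum_eq_zero fun i _ => ?_
      rw [smul_apply, rotOne_apply,
        E.hcls_eq_zero (p := (p - i).succ) (Fin.succ_ne_zero _) (c := c) (by simpa using h),
        smul_zero])
    (fun a p c => by
      rw [sum_apply, sum_apply]
      refine Finset.sum_congr rfl fun i _ => ?_
      rw [smul_apply, smul_apply, rotOne_balance])

/-! ### The comparison map `φ` -/

/-- The tensor `x ⊗ x^{l_m} ⊗ ⋯ ⊗ x ⊗ x^{l_1}` if `r = 2 * m`, and
`x ⊗ x^{l_m} ⊗ ⋯ ⊗ x ⊗ x^{l_1} ⊗ x` if `r = 2 * m + 1` (as a tuple; `l_{t+1}` is `l t`). -/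
def phiTail (r : ℕ) (l : Fin (r / 2) → ℕ) : Fin r → E.A := fun p =>
  if h : p.val % 2 = 1 then E.x ^ l (Fin.rev ⟨p.val / 2, by omega⟩) else E.x

/-- The summand `[lam_{n-i_1} ⋯ lam_{n-i_m} a x^{|i-l|-m} ⊗ x ⊗ x^{l_m} ⊗ ⋯]` of `φ_r [a]`. -/
def phiTerm (r : ℕ) (i l : Fin (r / 2) → ℕ) : E.A →ₗ[k] E.Hoch r where
  toFun a := E.hcls r (Fin.cons
    (E.incl (List.ofFn fun t => E.lam (E.n - i t)).prod * a * E.x ^ (∑ t, (i t - l t) - r / 2))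
    (E.phiTail r l))
  map_add' a b := by
    rw [mul_add, add_mul]
    exact (E.hcls r).cons_add _ _ _
  map_smul' s a := by
    rw [mul_smul_comm, smul_mul_assoc]
    exact (E.hcls r).cons_smul _ _ _

theorem hcls_move {r : ℕ} (t : Fin r → E.A) (e : Fin r → ℕ)
    (ht : ∀ p c, t p * E.incl c = E.incl ((E.α ^ e p) c) * t p) (b : E.A) (c : K) :
    E.hcls r (Fin.cons (b * E.incl ((E.α ^ ∑ p, e p) c)) t) =
      E.hcls r (Fin.cons (E.incl c * b) t) := by
  set w : Fin (r + 1) → E.A := Fin.cons b t with hw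
  let g : ℕ → ℕ := fun p => if h : p < r then e ⟨p, h⟩ else 0
  have claim : ∀ q (hq : q < r + 1) (c : K),
      E.hcls r (Function.update w ⟨q, hq⟩ (w ⟨q, hq⟩ * E.incl c)) =
        E.hcls r (Function.update w 0 (w 0 * E.incl ((E.α ^ ∑ p ∈ Finset.range q, g p) c))) := by
    intro q
    induction q with
    | zero => intro hq c; simp
    | succ q ih =>
      intro hq c
      have hq' : q < r := by omega
      have h1 : w ⟨q + 1, hq⟩ * E.incl c = E.incl ((E.α ^ g q) c) * w ⟨q + 1, hq⟩ := by
        have := ht ⟨q, hq'⟩ c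
        simp only [g, dif_pos hq']
        exact this
      have h2 : (⟨q + 1, hq⟩ : Fin (r + 1)) = ⟨q, by omega⟩ + 1 :=
        (Fin.coeSucc_eq_succ (a := (⟨q, hq'⟩ : Fin r))).symm
      rw [h1, h2, ← E.hcls_balance, ih, ← AlgHom.mul_apply, ← pow_add, Finset.sum_range_succ]
  have h3 := claim r (by omega) c
  have h4 : ∑ p ∈ Finset.range r, g p = ∑ p, e p := by
    rw [Finset.sum_range]
    exact Finset.sum_congr rfl fun p _ => by simp [g]
  have h5 := E.hcls_balance w (Fin.last r) c
  rw [Fin.last_add_one] at h5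
  rw [h4] at h3
  have h6 := h3.symm.trans h5
  simpa only [hw, Fin.update_cons_zero, Fin.cons_zero] using h6

theorem sum_pairs (g : ℕ → ℕ) (r : ℕ) :
    ∑ p ∈ Finset.range r, g p =
      ∑ t ∈ Finset.range (r / 2), (g (2 * t) + g (2 * t + 1)) + r % 2 * g (r - 1) := by
  have h : ∀ m, ∑ p ∈ Finset.range (2 * m), g p =
      ∑ t ∈ Finset.range m, (g (2 * t) + g (2 * t + 1)) := by
    intro m
    induction m with
    | zero => simp
    | succ m ih =>
      rw [show 2 * (m + 1) = 2 * m + 1 + 1 by ring, Finset.sum_range_succ, Finset.sum_range_succ,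
        Finset.sum_range_succ, ih, add_assoc]
  rcases Nat.even_or_odd' r with ⟨m, rfl | rfl⟩
  · simp [h]
  · rw [Finset.sum_range_succ, h, show (2 * m + 1) / 2 = m by omega,
      show (2 * m + 1) % 2 = 1 by omega]
    simp

theorem phiTerm_twist (r : ℕ) (i l : Fin (r / 2) → ℕ) (hi : ∀ t, 1 ≤ i t ∧ i t ≤ E.n)
    (hl : ∀ t, 1 ≤ l t ∧ l t < i t) (b : E.A) (c : K) :
    E.phiTerm r i l (b * E.incl ((E.α ^ E.twist r) c)) = E.phiTerm r i l (E.incl c * b) := by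
  let e : Fin r → ℕ := fun p =>
    if h : p.val % 2 = 1 then l (Fin.rev ⟨p.val / 2, by omega⟩) else 1
  have he : ∀ p c, E.phiTail r l p * E.incl c = E.incl ((E.α ^ e p) c) * E.phiTail r l p := by
    intro p c
    by_cases h : p.val % 2 = 1
    · simp only [phiTail, e, dif_pos h, x_pow_mul_incl]
    · simp only [phiTail, e, dif_neg h]
      simpa using E.x_pow_mul_incl 1 c
  have hsum : ∑ p, e p = ∑ t, l t + r / 2 + r % 2 := by
    let g : ℕ → ℕ := fun p => if h : p < r then e ⟨p, h⟩ else 0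
    have h1 : ∑ p, e p = ∑ p ∈ Finset.range r, g p := by
      rw [Finset.sum_range]
      exact Finset.sum_congr rfl fun p _ => by simp [g]
    rw [h1, sum_pairs, Finset.sum_range]
    have h2 : ∀ t : Fin (r / 2), g (2 * t.val) + g (2 * t.val + 1) = 1 + l (Fin.rev t) := by
      intro t
      have ht := t.isLt
      have ha : 2 * t.val < r := by omega
      have hb : 2 * t.val + 1 < r := by omega
      simp only [g, dif_pos ha, dif_pos hb, e]
      rw [dif_neg (by omega), dif_pos (by omega)]
      congr 3
      ext
      simp; omega
    rw [Finset.sum_congr rfl fun t _ => h2 t, Finset.sum_add_distrib,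
      Equiv.sum_comp Fin.revPerm l |>.symm]
    have h3 : r % 2 * g (r - 1) = r % 2 := by
      rcases Nat.mod_two_eq_zero_or_one r with h | h
      · simp [h]
      · have hr : r - 1 < r := by omega
        simp only [g, dif_pos hr, e]
        rw [dif_neg (by omega), mul_one]
    rw [h3]
    simp [add_comm]
  have hlam : ∀ (N : ℕ) (j : Fin N → ℕ), (∀ t, 1 ≤ j t ∧ j t ≤ E.n) → ∀ c : K,
      (List.ofFn fun t => E.lam (E.n - j t)).prod * c =
        (E.α ^ ∑ t, (E.n - j t)) c * (List.ofFn fun t => E.lam (E.n - j t)).prod := by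
    intro N
    induction N with
    | zero => intro j _ c; simp
    | succ N ih =>
      intro j hj c
      rw [List.ofFn_succ, List.prod_cons, Fin.sum_univ_succ, mul_assoc,
        ih (fun t => j t.succ) (fun t => hj t.succ), ← mul_assoc]
      have : ∀ d : K, E.lam (E.n - j 0) * d = (E.α ^ (E.n - j 0)) d * E.lam (E.n - j 0) := by
        intro d
        rcases Nat.eq_zero_or_pos (E.n - j 0) with h | h
        · simp [h, E.lam_zero]
        · exact E.lam_mul _ h (Nat.sub_le _ _) d
      rw [this, mul_assoc, pow_add, AlgHom.mul_apply]
  change E.hcls r (Fin.cons _ _) = E.hcls r (Fin.cons _ _)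
  set L := (List.ofFn fun t => E.lam (E.n - i t)).prod with hL
  set s := ∑ t, (i t - l t) - r / 2 with hs
  have e1 : E.incl L * (E.incl c * b) * E.x ^ s =
      E.incl ((E.α ^ ∑ t, (E.n - i t)) c) * (E.incl L * b * E.x ^ s) := by
    simp only [← mul_assoc, ← map_mul]
    rw [hlam _ i hi]
  rw [e1, ← E.hcls_move (E.phiTail r l) e he, mul_assoc _ (E.x ^ s), x_pow_mul_incl]
  congr 2
  rw [← AlgHom.mul_apply, ← AlgHom.mul_apply, ← pow_add, ← pow_add]
  have hexp : s + ∑ p, e p + ∑ t, (E.n - i t) = E.twist r := by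
    have h1 : r / 2 ≤ ∑ t, (i t - l t) := by
      calc r / 2 = ∑ t : Fin (r / 2), 1 := by simp
        _ ≤ _ := Finset.sum_le_sum fun t _ => by have := hl t; omega
    have h2 : ∑ t, (i t - l t) + ∑ t, l t + ∑ t, (E.n - i t) = r / 2 * E.n := by
      rw [← Finset.sum_add_distrib, ← Finset.sum_add_distrib]
      calc _ = ∑ t : Fin (r / 2), E.n :=
            Finset.sum_congr rfl fun t _ => by have := hl t; have := hi t; omega
        _ = _ := by simp
    rw [hsum, twist]
    omega
  rw [hexp]
  simp only [mul_assoc]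

/-- `φ_r` before passing to the quotient `C^S_r(A)`. -/
def phiSum (r : ℕ) : E.A →ₗ[k] E.Hoch r :=
  ∑ i ∈ Fintype.piFinset fun _ : Fin (r / 2) => Finset.Icc 1 E.n,
    ∑ l ∈ Fintype.piFinset fun t : Fin (r / 2) => Finset.Ico 1 (i t), E.phiTerm r i l

theorem twistedComm_le_ker_phiSum (r : ℕ) : E.twistedComm (E.twist r) ≤ (E.phiSum r).ker := by
  refine Submodule.span_le.2 ?_
  rintro _ ⟨b, c, rfl⟩
  change E.phiSum r _ = 0
  simp only [phiSum, map_sub, LinearMap.sum_apply, sub_eq_zero]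
  refine Finset.sum_congr rfl fun i hi => Finset.sum_congr rfl fun l hl => ?_
  simp only [Fintype.mem_piFinset, Finset.mem_Icc, Finset.mem_Ico] at hi hl
  exact E.phiTerm_twist r i l hi hl b c

/-- The comparison map `φ_r : C^S_r(A) → A ⊗_K Ā^{⊗_K r} ⊗_K`,
`φ_r [a] = ∑_i ∑_l [lam_{n-i_1} ⋯ lam_{n-i_m} a x^{|i-l|-m} ⊗ x ⊗ x^{l_m} ⊗ ⋯ ⊗ x ⊗ x^{l_1} (⊗ x)]`,
where `m = r / 2`, the sum runs over `1 ≤ i_t ≤ n`, `1 ≤ l_t < i_t`, and the last factor `x` is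
present when `r` is odd. -/
def phi (r : ℕ) : E.CS r →ₗ[k] E.Hoch r :=
  (E.twistedComm (E.twist r)).liftQ (E.phiSum r) (E.twistedComm_le_ker_phiSum r)

/-! ### The comparison map `ψ` -/

theorem quo_X_pow_mul_incl (s : ℕ) (c : K) :
    E.toA (E.quo (E.X ^ s)) * E.incl ((E.α ^ E.n) c) =
      E.incl ((E.α ^ s) c) * E.toA (E.quo (E.X ^ s)) := by
  have h1 : E.quo (E.X ^ s * E.C c) = E.quo (E.X ^ s) * E.C ((E.α ^ E.n) c) := by
    refine E.quo_eq ?_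
    have := (E.quo_spec (E.X ^ s)).mul_C c
    rwa [sub_mul, mul_assoc _ E.f, f_mul_C, ← mul_assoc] at this
  have h2 : E.quo (E.C ((E.α ^ s) c) * E.X ^ s) = E.C ((E.α ^ s) c) * E.quo (E.X ^ s) := by
    refine E.quo_eq ?_
    have := (E.quo_spec (E.X ^ s)).C_mul ((E.α ^ s) c)
    rwa [mul_sub, ← mul_assoc] at this
  rw [X_pow_mul_C, h2] at h1
  have := congrArg E.toA h1
  rw [map_mul, map_mul] at this
  exact this.symm

/-- The product `Q_0 Q_1 ⋯ Q_{m-1}` in `A`, where `Q_t` is the class of the quotient of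
`x ^ (i (2 t) + i (2 t + 1))` by `f`. -/
def quoProd (m : ℕ) (i : ℕ → ℕ) : E.A :=
  ((List.range m).map fun t => E.toA (E.quo (E.X ^ (i (2 * t) + i (2 * t + 1))))).prod

theorem quoProd_mul_incl (m : ℕ) (i : ℕ → ℕ) (c : K) :
    E.quoProd m i * E.incl ((E.α ^ (m * E.n)) c) =
      E.incl ((E.α ^ ∑ t ∈ Finset.range m, (i (2 * t) + i (2 * t + 1))) c) * E.quoProd m i := by
  induction m generalizing c with
  | zero => simp [quoProd]
  | succ m ih =>
    have h : E.quoProd (m + 1) i =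
        E.quoProd m i * E.toA (E.quo (E.X ^ (i (2 * m) + i (2 * m + 1)))) := by
      simp [quoProd, List.range_succ]
    rw [h, Finset.sum_range_succ, show (m + 1) * E.n = E.n + m * E.n by ring, pow_add E.α E.n,
      AlgHom.mul_apply, mul_assoc, quo_X_pow_mul_incl, ← AlgHom.mul_apply, pow_mul_comm,
      AlgHom.mul_apply, ← mul_assoc, ih, ← AlgHom.mul_apply, ← pow_add E.α, mul_assoc]

theorem quoProd_eq_zero {m : ℕ} {i : ℕ → ℕ} {t : ℕ} (ht : t < m)
    (h : i (2 * t) + i (2 * t + 1) < E.n) : E.quoProd m i = 0 := by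
  refine List.prod_eq_zero (List.mem_map.2 ⟨t, List.mem_range.2 ht, ?_⟩)
  rw [E.quo_eq (Q := 0) (by simpa using E.isLow_X_pow h), map_zero]

/-- The map `a ↦ ψ_r [a ⊗ x^{i 0} ⊗ ⋯ ⊗ x^{i (r - 1)}]`; with `Q = quoProd (r / 2) i`, it is
`a ↦ [a Q]` if `r` is even, and `a ↦ ∑_{l < s} [x^{s-l-1} a Q x^l]`, where `s = i (r - 1)`, if
`r` is odd. -/
def psiMono (r : ℕ) (i : ℕ → ℕ) : E.A →ₗ[k] E.CS r where
  toFun a := if r % 2 = 0 then E.cls r (a * E.quoProd (r / 2) i) else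
    ∑ l ∈ Finset.range (i (r - 1)),
      E.cls r (E.x ^ (i (r - 1) - l - 1) * a * E.quoProd (r / 2) i * E.x ^ l)
  map_add' a b := by
    split_ifs
    · rw [add_mul, map_add]
    · simp only [mul_add, add_mul, map_add, Finset.sum_add_distrib]
  map_smul' s a := by
    split_ifs
    · rw [smul_mul_assoc, map_smul, RingHom.id_apply]
    · simp only [mul_smul_comm, smul_mul_assoc, map_smul, Finset.smul_sum, RingHom.id_apply]

theorem psiMono_twist (r : ℕ) (i : ℕ → ℕ) (a : E.A) (c : K) :
    E.psiMono r i (a * E.incl ((E.α ^ ∑ t ∈ Finset.range r, i t) c)) =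
      E.psiMono r i (E.incl c * a) := by
  change (if r % 2 = 0 then _ else _) = (if r % 2 = 0 then _ else _)
  rw [sum_pairs]
  split_ifs with h
  · rw [h, zero_mul, add_zero, mul_assoc, ← quoProd_mul_incl, ← mul_assoc, mul_assoc (E.incl c),
      ← cls_twist]
    simp [twist, h]
  · have h' : r % 2 = 1 := by omega
    refine Finset.sum_congr rfl fun l hl => ?_
    have hl' := Finset.mem_range.1 hl
    rw [h', one_mul, pow_add, AlgHom.mul_apply]
    set s := i (r - 1) with hs
    set Q := E.quoProd (r / 2) i with hQ
    have e1 : E.x ^ (s - l - 1) * (E.incl c * a) * Q * E.x ^ l =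
        E.incl ((E.α ^ (s - l - 1)) c) * (E.x ^ (s - l - 1) * a * Q * E.x ^ l) := by
      rw [← mul_assoc, x_pow_mul_incl]; simp only [mul_assoc]
    have e2 : E.x ^ (s - l - 1) * (a * E.incl ((E.α ^ ∑ t ∈ Finset.range (r / 2),
          (i (2 * t) + i (2 * t + 1))) ((E.α ^ s) c))) * Q * E.x ^ l =
        E.x ^ (s - l - 1) * a * Q * E.x ^ l *
          E.incl ((E.α ^ E.twist r) ((E.α ^ (s - l - 1)) c)) := by
      have h3 : (E.α ^ l) ((E.α ^ E.twist r) ((E.α ^ (s - l - 1)) c)) =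
          (E.α ^ (r / 2 * E.n)) ((E.α ^ s) c) := by
        rw [← AlgHom.mul_apply, ← AlgHom.mul_apply, ← AlgHom.mul_apply, ← pow_add, ← pow_add,
          ← pow_add, twist, h']
        congr 2
        omega
      have h4 := E.quoProd_mul_incl (r / 2) i ((E.α ^ s) c)
      rw [← hQ] at h4
      rw [mul_assoc (E.x ^ (s - l - 1) * a * Q), x_pow_mul_incl, h3,
        mul_assoc (E.x ^ (s - l - 1) * a) Q, ← mul_assoc Q, h4]
      simp only [mul_assoc]
    rw [e1, e2, cls_twist]

theorem psiMono_eq_zero {r : ℕ} {i : ℕ → ℕ} (hi : ∀ t, i t < E.n) {p : ℕ} (hp : p < r)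
    (h : i p = 0) (a : E.A) : E.psiMono r i a = 0 := by
  change (if r % 2 = 0 then _ else _) = _
  rcases Nat.lt_or_ge (p / 2) (r / 2) with hlt | hge
  · have : E.quoProd (r / 2) i = 0 := by
      refine E.quoProd_eq_zero hlt ?_
      rcases Nat.mod_two_eq_zero_or_one p with h2 | h2
      · rw [show 2 * (p / 2) = p by omega, h, zero_add]; exact hi _
      · rw [show 2 * (p / 2) + 1 = p by omega, h, add_zero]; exact hi _
    simp [this]
  · have h1 : r - 1 = p := by omega
    rw [if_neg (by omega), h1, h]
    simp

/-- The linear maps used to expand `a 0 ⊗ a 1 ⊗ ⋯ ⊗ a r` in terms of the tensors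
`a ⊗ x^{i 0} ⊗ ⋯ ⊗ x^{i (r - 1)}`: the identity on the factor `0`, and on the factor `p + 1` the
coordinate at `x^{i p}`, twisted by `α^(i 0 + ⋯ + i (p - 1))` because it has to be moved to the left
across `x^{i 0} ⊗ ⋯ ⊗ x^{i (p - 1)}`. -/
def psiFactor (r : ℕ) (i : ℕ → ℕ) : Fin (r + 1) → (E.A →ₗ[k] E.A) :=
  Fin.cons LinearMap.id fun p : Fin r =>
    E.incl.toLinearMap ∘ₗ (E.α ^ ∑ t ∈ Finset.range p, i t).toLinearMap ∘ₗ E.coord (i p)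

/-- The left coefficient at `x^{i 0} ⊗ ⋯ ⊗ x^{i (r - 1)}` of `a 0 ⊗ a 1 ⊗ ⋯ ⊗ a r`, an element
of `A`. -/
def psiCoeff (r : ℕ) (i : ℕ → ℕ) : MultilinearMap k (fun _ : Fin (r + 1) => E.A) E.A :=
  (MultilinearMap.mkPiAlgebraFin k (r + 1) E.A).compLinearMap (E.psiFactor r i)

theorem psiCoeff_apply (r : ℕ) (i : ℕ → ℕ) (a : Fin (r + 1) → E.A) :
    E.psiCoeff r i a = (List.ofFn fun p => E.psiFactor r i p (a p)).prod := by
  simp [psiCoeff]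

theorem psiFactor_mul_incl (r : ℕ) (i : ℕ → ℕ) (p : Fin (r + 1)) (a : E.A) (c : K) :
    E.psiFactor r i p (a * E.incl c) =
      E.psiFactor r i p a * E.incl ((E.α ^ ∑ t ∈ Finset.range p, i t) c) := by
  induction p using Fin.cases with
  | zero => simp [psiFactor]
  | succ p =>
    simp only [psiFactor, Fin.cons_succ, LinearMap.comp_apply, AlgHom.toLinearMap_apply,
      coord_mul_incl, map_mul, Fin.val_succ, Finset.sum_range_succ, pow_add, AlgHom.mul_apply]

theorem psiFactor_incl_mul (r : ℕ) (i : ℕ → ℕ) (p : Fin r) (a : E.A) (c : K) :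
    E.psiFactor r i p.succ (E.incl c * a) =
      E.incl ((E.α ^ ∑ t ∈ Finset.range p, i t) c) * E.psiFactor r i p.succ a := by
  simp only [psiFactor, Fin.cons_succ, LinearMap.comp_apply, AlgHom.toLinearMap_apply,
      coord_incl_mul, map_mul]

theorem ofFn_prod_balance {M : Type*} [Monoid M] {N : ℕ} (b : Fin (N + 1) → M) (p : Fin N) (y : M) :
    (List.ofFn (Function.update b p.castSucc (b p.castSucc * y))).prod =
      (List.ofFn (Function.update b p.succ (y * b p.succ))).prod := by
  induction N with
  | zero => exact p.elim0
  | succ N ih =>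
    have hs : ∀ (q : Fin (N + 1)) (z : M), (fun j : Fin (N + 1) =>
        Function.update b q.succ z j.succ) = Function.update (fun j => b j.succ) q z := by
      intro q z
      funext j
      by_cases h : j = q
      · subst h; simp
      · rw [Function.update_of_ne h, Function.update_of_ne (by simpa using h)]
    induction p using Fin.cases with
    | zero =>
      rw [List.ofFn_succ, List.ofFn_succ (f := Function.update b (Fin.succ 0) _), hs]
      rw [List.ofFn_succ, List.ofFn_succ (f := Function.update (fun j => b j.succ) 0 _)]
      simp [mul_assoc]
    | succ p =>
      have := ih (fun j => b j.succ) p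
      rw [List.ofFn_succ, List.ofFn_succ (f := Function.update b p.succ.succ _), hs,
        ← Fin.succ_castSucc, hs, List.prod_cons, List.prod_cons, this,
        Function.update_of_ne (Fin.succ_ne_zero _).symm,
        Function.update_of_ne (Fin.succ_ne_zero _).symm]

theorem psiCoeff_balance (r : ℕ) (i : ℕ → ℕ) (a : Fin (r + 1) → E.A) (p : Fin r) (c : K) :
    E.psiCoeff r i (Function.update a p.castSucc (a p.castSucc * E.incl c)) =
      E.psiCoeff r i (Function.update a p.succ (E.incl c * a p.succ)) := by
  have hu : ∀ (q : Fin (r + 1)) (z : E.A),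
      (fun j => E.psiFactor r i j (Function.update a q z j)) =
        Function.update (fun j => E.psiFactor r i j (a j)) q (E.psiFactor r i q z) := by
    intro q z
    funext j
    by_cases h : j = q
    · subst h; simp
    · rw [Function.update_of_ne h, Function.update_of_ne h]
  rw [psiCoeff_apply, psiCoeff_apply, hu, hu, psiFactor_mul_incl, psiFactor_incl_mul]
  exact ofFn_prod_balance (fun j => E.psiFactor r i j (a j)) p _

theorem psiCoeff_last (r : ℕ) (i : ℕ → ℕ) (a : Fin (r + 1) → E.A) (c : K) :
    E.psiCoeff r i (Function.update a (Fin.last r) (a (Fin.last r) * E.incl c)) =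
      E.psiCoeff r i a * E.incl ((E.α ^ ∑ t ∈ Finset.range r, i t) c) := by
  rw [psiCoeff_apply, psiCoeff_apply, List.ofFn_succ_last, List.ofFn_succ_last, List.prod_append,
    List.prod_append]
  simp only [Function.update_self, psiFactor_mul_incl, List.prod_singleton, Fin.val_last,
    ← mul_assoc]
  congr 4
  funext j
  rw [Function.update_of_ne (Fin.castSucc_ne_last j)]

theorem psiCoeff_first (r : ℕ) (i : ℕ → ℕ) (a : Fin (r + 1) → E.A) (c : K) :
    E.psiCoeff r i (Function.update a 0 (E.incl c * a 0)) = E.incl c * E.psiCoeff r i a := by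
  rw [psiCoeff_apply, psiCoeff_apply, List.ofFn_succ, List.ofFn_succ, List.prod_cons,
    List.prod_cons]
  simp [psiFactor, mul_assoc]

/-- Extension of a tuple by zero. -/
def extend {r : ℕ} (i : Fin r → ℕ) : ℕ → ℕ := fun t => if h : t < r then i ⟨t, h⟩ else 0

/-- The comparison map `ψ_r : A ⊗_K Ā^{⊗_K r} ⊗_K → C^S_r(A)`.  It is the `k`-linear map whose value
at `[a ⊗ x^{i_1} ⊗ ⋯ ⊗ x^{i_r}]` (`0 ≤ i_t < n`) is given by `psiMono`. -/
def psi (r : ℕ) : E.Hoch r →ₗ[k] E.CS r :=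
  E.hochLift r
    (∑ i ∈ Fintype.piFinset fun _ : Fin r => Finset.range E.n,
      (E.psiMono r (extend i)).compMultilinearMap (E.psiCoeff r (extend i)))
    (fun a p c hp h => by
      rw [sum_apply]
      refine Finset.sum_eq_zero fun i hi => ?_
      simp only [Fintype.mem_piFinset, Finset.mem_range] at hi
      have hn := E.two_le
      have hlt : ∀ t, extend i t < E.n := by
        intro t
        simp only [extend]
        split_ifs
        · exact hi _
        · omega
      rw [LinearMap.compMultilinearMap_apply]
      obtain ⟨p, rfl⟩ := Fin.exists_succ_eq.2 hp
      by_cases h0 : extend i p = 0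
      · exact E.psiMono_eq_zero hlt p.isLt h0 _
      · have h2 : E.psiCoeff r (extend i) a = 0 := by
          rw [psiCoeff_apply]
          refine List.prod_eq_zero ((List.mem_ofFn' _ _).2 ⟨p.succ, ?_⟩)
          simp only [psiFactor, Fin.cons_succ, LinearMap.comp_apply, h]
          rw [E.coord_incl_of_ne_zero h0, map_zero, map_zero]
        rw [h2, map_zero])
    (fun a p c => by
      rw [sum_apply, sum_apply]
      refine Finset.sum_congr rfl fun i hi => ?_
      rw [LinearMap.compMultilinearMap_apply, LinearMap.compMultilinearMap_apply]
      induction p using Fin.lastCases with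
      | last => rw [Fin.last_add_one, psiCoeff_last, psiCoeff_first, psiMono_twist]
      | cast p => rw [Fin.coeSucc_eq_succ, psiCoeff_balance])

/-- `ψ_r [a ⊗ x^{i_1} ⊗ ⋯ ⊗ x^{i_r}]`, for `0 ≤ i_t < n`. -/
theorem psi_monomial (r : ℕ) (a : E.A) (i : Fin r → ℕ) (hi : ∀ t, i t < E.n) :
    E.psi r (E.hcls r (Fin.cons a fun t => E.x ^ i t)) = E.psiMono r (extend i) a := by
  have hcoord : ∀ s, s < E.n → ∀ j, E.coord j (E.x ^ s) = if s = j then 1 else 0 := by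
    intro s hs j
    change E.coeff (E.low (E.toA E.X ^ s)) j = _
    rw [← map_pow, low_mk _ (E.isLow_X_pow hs)]
    simpa using E.coeff_C_mul_X_pow 1 s j
  rw [psi, hochLift_hcls, sum_apply, Finset.sum_eq_single i]
  · rw [LinearMap.compMultilinearMap_apply, psiCoeff_apply, List.ofFn_succ, List.prod_cons,
      List.prod_eq_one]
    · simp [psiFactor]
    · intro y hy
      obtain ⟨t, rfl⟩ := (List.mem_ofFn' _ _).1 hy
      have : extend i t = i t := by simp [extend]
      simp [psiFactor, hcoord _ (hi t), this]
  · intro j hj hne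
    simp only [Fintype.mem_piFinset, Finset.mem_range] at hj
    obtain ⟨t, ht⟩ : ∃ t, i t ≠ j t := by
      by_contra! hcon
      exact hne (funext fun t => (hcon t).symm)
    rw [LinearMap.compMultilinearMap_apply, psiCoeff_apply, List.prod_eq_zero, map_zero]
    refine (List.mem_ofFn' _ _).2 ⟨t.succ, ?_⟩
    have : extend j t = j t := by simp [extend]
    simp [psiFactor, hcoord _ (hi t), this, ht]
  · intro h
    exact absurd (by simpa using hi) h

/-! ### The operator `D` -/

/-- The Connes operator `D_r = ψ_{r+1} ∘ B_r ∘ φ_r : C^S_r(A) → C^S_{r+1}(A)`. -/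
def D (r : ℕ) : E.CS r →ₗ[k] E.CS (r + 1) := E.psi (r + 1) ∘ₗ E.B r ∘ₗ E.phi r

end MonogenicDatum

end

/-!
The operator `D_r` is evaluated by following `[a]` through `φ`, the cyclic permutations and `ψ`.

Index the permutations by the position `q` at which they put the coefficient factor `b` of a term
of `φ_r [a]`. The other factors are powers of `x`, so expanding `b` in the basis
`1, x, …, x ^ (n - 1)` and moving its coordinates to the front, which twists them by powers of `α`,
brings `ψ` into its defining form (`psi_update`, `D_cls`). In the resulting product of quotients, a
pair `(x, x ^ l)` or `(x ^ l, x)` contributes the quotient of `x ^ (l + 1)` by `f`, which is `1` if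
`l = n - 1` and `0` if `l < n - 1`. Hence a term survives only if all the `l_t` paired with an `x`
equal `n - 1`, which forces `i_t = n` and leaves the coefficient `lam 0 = 1` (`rotVal_eq_zero`).

* If `r` is odd, every `l_t` is paired with an `x`, so only one term of `φ_r [a]` survives, and each
  permutation gives the coordinate of `a` at `x ^ (n - 1)` twisted by a power of `α`, with
  alternating signs (`rotVal_of_odd`).
* If `r` is even, all signs are `1`. The permutation `q = r` gives the first summand of the formula
  (`rotVal_of_even_self`). For `q = 2 w` and `q = 2 w + 1` with `w < r / 2` exactly one exponent `l`
  stays free: it is the last factor for `q = 2 w`, where `ψ` turns it into a sum of `l` terms, and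
  it is paired with `b` for `q = 2 w + 1`. These two contributions are
  `sum_rotVal_two_mul` and `sum_rotVal_two_mul_add_one`.

In the even case, the factor `b` has to be replaced by its remainder modulo `f`. For
`b = μ * x ^ N`, the quotient of the product of this remainder with `x ^ l` is the quotient of
`μ * x ^ (N + l)` minus that of `μ * x ^ N` times `x ^ l` (`quo_low_mul_X_pow`). The first parts add
up to the wanted summand, except for its terms with `l = 0`. The contribution of `q = 2 w` supplies
these terms and cancels the second parts, because the quotient of `x ^ (N + 1)` is that of `x ^ N`
times `x`, plus the leading coefficient of the remainder of `x ^ N` (`quo_mul_X`,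
`sum_quoX_telescope`). The coefficients of `f` and of the remainders of powers of `x` are fixed by
`α` (`commute_low_x_pow`), so the twists act only on the scalar of the argument.
-/

noncomputable section

universe u v

namespace MonogenicDatum

variable {k : Type u} {K : Type v} [CommRing k] [Ring K] [Algebra k K] (E : MonogenicDatum k K)

/-! ### Division by `f` -/

theorem quo_add (P Q : E.Ore) : E.quo (P + Q) = E.quo P + E.quo Q := by
  refine E.quo_eq ?_
  have := (E.quo_spec P).add (E.quo_spec Q)
  rwa [show P + Q - (E.quo P + E.quo Q) * E.f =
    P - E.quo P * E.f + (Q - E.quo Q * E.f) by noncomm_ring]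

theorem quo_of_isLow {P : E.Ore} (h : E.IsLow P) : E.quo P = 0 :=
  E.quo_eq (by simpa using h)

theorem quo_sum {ι : Type*} (s : Finset ι) (P : ι → E.Ore) :
    E.quo (∑ i ∈ s, P i) = ∑ i ∈ s, E.quo (P i) := by
  classical
  induction s using Finset.induction_on with
  | empty => simpa using E.quo_of_isLow E.isLow_zero
  | insert a s ha ih => rw [Finset.sum_insert ha, Finset.sum_insert ha, quo_add, ih]

theorem quo_C_mul (c : K) (P : E.Ore) : E.quo (E.C c * P) = E.C c * E.quo P := by
  refine E.quo_eq ?_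
  have := (E.quo_spec P).C_mul c
  rwa [mul_sub, ← mul_assoc] at this

theorem low_toA (P : E.Ore) : E.low (E.toA P) = P - E.quo P * E.f := by
  rw [← E.low_mk (E.quo_spec P), map_sub, (E.toA_eq_zero _).2 ⟨_, rfl⟩, sub_zero]

theorem quo_X_pow_n : E.quo (E.X ^ E.n) = 1 := by
  obtain ⟨g, hg, hf⟩ := E.f_eq
  refine E.quo_eq ?_
  rw [one_mul, hf, sub_add_cancel_left]
  exact hg.neg

theorem coord_eq_coeff_low (i : ℕ) (a : E.A) : E.coord i a = E.coeff (E.low a) i := rfl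

theorem coeff_mul_X (P : E.Ore) (j : ℕ) : E.coeff (P * E.X) (j + 1) = E.coeff P j := by
  simp only [← coeffHom_apply]
  induction P using E.ore_induction with
  | h0 => simp
  | ha P Q hP hQ => rw [add_mul, map_add, map_add, hP, hQ]
  | hm b l =>
    rw [mul_assoc, ← pow_succ]
    simp [coeffHom_apply, coeff_C_mul_X_pow]

theorem coeff_X_mul (P : E.Ore) (j : ℕ) : E.coeff (E.X * P) (j + 1) = E.α (E.coeff P j) := by
  simp only [← coeffHom_apply]
  induction P using E.ore_induction with
  | h0 => simp
  | ha P Q hP hQ => rw [mul_add, map_add, map_add, hP, hQ, map_add]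
  | hm b l =>
    have := E.C_mul_X_pow_mul 1 b 1 l
    rw [map_one, one_mul, one_mul, pow_one, pow_one] at this
    rw [this]
    simp [coeffHom_apply, coeff_C_mul_X_pow, add_comm 1 l, apply_ite E.α]

/-- One more factor `x` on the right shifts the quotient and adds the leading coefficient of the
remainder, since `f` commutes with `x`. -/
theorem quo_mul_X (P : E.Ore) :
    E.quo (P * E.X) = E.quo P * E.X + E.C (E.coord (E.n - 1) (E.toA P)) := by
  obtain ⟨g, hg, hf⟩ := E.f_eq
  have h2 := E.two_le
  refine E.quo_eq ?_
  have hR := E.quo_spec P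
  have hc : E.coord (E.n - 1) (E.toA P) = E.coeff (P - E.quo P * E.f) (E.n - 1) := by
    rw [← low_toA]; rfl
  rw [hc]
  set R := P - E.quo P * E.f
  set c := E.coeff R (E.n - 1)
  have hP : P = E.quo P * E.f + R := by simp [R]
  have e : P * E.X - (E.quo P * E.X + E.C c) * E.f =
      (R * E.X - E.C c * E.X ^ E.n) + -(E.C c * g) := by
    nth_rw 1 [hP]
    rw [add_mul, add_mul, mul_assoc, f_mul_X, ← mul_assoc, hf]
    noncomm_ring
  rw [e]
  refine IsLow.add (fun j hj => ?_) (hg.C_mul _).neg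
  rw [← coeffHom_apply, map_sub, coeffHom_apply, coeffHom_apply, coeff_C_mul_X_pow]
  obtain ⟨j, rfl⟩ : ∃ l, j = l + 1 := ⟨j - 1, by omega⟩
  rw [coeff_mul_X]
  split_ifs with h
  · simp [c, h]
  · rw [hR j (by omega), sub_zero]

/-- Replacing `P` by its remainder before multiplying by `x ^ l` removes `P̄ * x ^ l` from the
quotient. -/
theorem quo_low_mul_X_pow (P : E.Ore) (l : ℕ) :
    E.quo (E.low (E.toA P) * E.X ^ l) = E.quo (P * E.X ^ l) - E.quo P * E.X ^ l := by
  refine E.quo_eq ?_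
  have := E.quo_spec (P * E.X ^ l)
  rwa [low_toA, sub_mul, sub_mul, mul_assoc _ E.f, f_mul_X_pow, ← mul_assoc,
    sub_sub_sub_cancel_right]

/-- The remainders of the powers of `x` commute with `x`: their coefficients are fixed by `α`. -/
theorem commute_low_x_pow (N : ℕ) : E.X * E.low (E.x ^ N) = E.low (E.x ^ N) * E.X := by
  have hx : ∀ N, E.x ^ N = E.toA (E.X ^ N) := fun N => (map_pow _ _ _).symm
  induction N with
  | zero =>
    have := E.two_le
    rw [hx, E.low_mk (E.isLow_X_pow (by omega))]
    simp
  | succ N ih =>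
    have h1 : E.low (E.x ^ (N + 1)) =
        E.low (E.x ^ N) * E.X - E.C (E.coord (E.n - 1) (E.x ^ N)) * E.f := by
      rw [hx, hx, low_toA, low_toA, pow_succ, quo_mul_X, sub_mul, add_mul, mul_assoc _ E.f, f_mul_X]
      noncomm_ring
    have h2 : E.α (E.coord (E.n - 1) (E.x ^ N)) = E.coord (E.n - 1) (E.x ^ N) := by
      have := congrArg (E.coeff · (E.n - 1 + 1)) ih
      simpa only [coeff_X_mul, coeff_mul_X, coord_eq_coeff_low] using this
    have h3 := E.X_pow_mul_C 1 (E.coord (E.n - 1) (E.x ^ N))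
    simp only [pow_one, h2] at h3
    rw [h1, mul_sub, sub_mul, ← mul_assoc, ih, ← mul_assoc, h3, mul_assoc _ E.X E.X,
      mul_assoc _ E.X E.f, ← f_mul_X, mul_assoc _ E.f]

theorem α_coord_x_pow (p s N : ℕ) : (E.α ^ p) (E.coord s (E.x ^ N)) = E.coord s (E.x ^ N) := by
  have h : E.α (E.coord s (E.x ^ N)) = E.coord s (E.x ^ N) := by
    have := congrArg (E.coeff · (s + 1)) (E.commute_low_x_pow N)
    simpa only [coeff_X_mul, coeff_mul_X, coord_eq_coeff_low] using this
  induction p with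
  | zero => simp
  | succ p ih => rw [pow_succ, AlgHom.mul_apply, h, ih]

theorem α_pow_lam (p : ℕ) {i : ℕ} (hi : i ≤ E.n) : (E.α ^ p) (E.lam i) = E.lam i := by
  have h : E.α (E.lam i) = E.lam i := by
    rcases Nat.eq_zero_or_pos i with rfl | h
    · simp [E.lam_zero]
    · exact E.α_lam i h hi
  induction p with
  | zero => simp
  | succ p ih => rw [pow_succ, AlgHom.mul_apply, h, ih]

theorem α_pow_coord (p s N : ℕ) {i : ℕ} (hi : i ≤ E.n) (c : K) :
    (E.α ^ p) (E.coord s (E.incl (E.lam i * c) * E.x ^ N)) =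
      E.coord s (E.incl (E.lam i * (E.α ^ p) c) * E.x ^ N) := by
  rw [coord_incl_mul, coord_incl_mul, map_mul, map_mul, α_coord_x_pow, α_pow_lam _ _ hi]

/-- The class in `A` of the quotient of `x ^ s` by `f`. -/
def quoX (s : ℕ) : E.A := E.toA (E.quo (E.X ^ s))

theorem quoX_of_lt {s : ℕ} (h : s < E.n) : E.quoX s = 0 := by
  rw [quoX, E.quo_of_isLow (E.isLow_X_pow h), map_zero]

theorem quoX_n : E.quoX E.n = 1 := by rw [quoX, quo_X_pow_n, map_one]

theorem quoX_succ (s : ℕ) :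
    E.quoX (s + 1) = E.quoX s * E.x + E.incl (E.coord (E.n - 1) (E.x ^ s)) := by
  rw [quoX, pow_succ, quo_mul_X, map_add, map_mul, map_pow]; rfl

/-- The quotient of `x ^ (j + N)` collects the leading coefficients of the remainders of the
previous powers of `x`; those of the powers below `x ^ j` vanish because `j < n`. -/
theorem quoX_add {j : ℕ} (hj : j < E.n) (N : ℕ) :
    E.quoX (j + N) =
      ∑ s ∈ Finset.range N, E.incl (E.coord (E.n - 1) (E.x ^ (j + s))) * E.x ^ (N - 1 - s) := by
  induction N with
  | zero => simpa using E.quoX_of_lt hj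
  | succ N ih =>
    rw [← add_assoc, quoX_succ, ih, Finset.sum_range_succ, Finset.sum_mul]
    congr 1
    · refine Finset.sum_congr rfl fun s hs => ?_
      have := Finset.mem_range.1 hs
      rw [mul_assoc, ← pow_succ]
      congr 2
      omega
    · simp

theorem low_eq_sum (a : E.A) :
    E.low a = ∑ s ∈ Finset.range E.n, E.C (E.coord s a) * E.X ^ s := by
  refine E.ore_ext fun i => ?_
  rw [← E.coeffHom_apply i (∑ s ∈ Finset.range E.n, _), map_sum]
  simp only [coeffHom_apply, coeff_C_mul_X_pow, Finset.sum_ite_eq', Finset.mem_range]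
  split_ifs with hi
  · rfl
  · exact E.low_isLow a i (by omega)

theorem eq_sum_coord (a : E.A) :
    a = ∑ s ∈ Finset.range E.n, E.incl (E.coord s a) * E.x ^ s := by
  conv_lhs => rw [← E.toA_low a, E.low_eq_sum a]
  simp [incl, x]

theorem sum_coord_mul_quoX (a : E.A) (l : ℕ) :
    ∑ s ∈ Finset.range E.n, E.incl (E.coord s a) * E.quoX (s + l) =
      E.toA (E.quo (E.low a * E.X ^ l)) := by
  rw [low_eq_sum, Finset.sum_mul, quo_sum, map_sum]
  refine Finset.sum_congr rfl fun s _ => ?_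
  rw [mul_assoc, ← pow_add, quo_C_mul, map_mul]; rfl

theorem sum_incl_mul_quoX_succ (g : ℕ → K) :
    ∑ s ∈ Finset.range E.n, E.incl (g s) * E.quoX (s + 1) = E.incl (g (E.n - 1)) := by
  have h2 := E.two_le
  rw [Finset.sum_eq_single (E.n - 1)]
  · rw [show E.n - 1 + 1 = E.n by omega, quoX_n, mul_one]
  · intro s hs hne
    rw [E.quoX_of_lt (by have := Finset.mem_range.1 hs; omega), mul_zero]
  · intro h
    exact absurd (Finset.mem_range.2 (by omega)) h

/-- The sum on the left is the quotient by `f` of the product of the remainder of `c * x ^ N` with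
`x ^ l`. -/
theorem sum_coord_monomial_mul_quoX (c : K) (N l : ℕ) :
    ∑ s ∈ Finset.range E.n, E.incl (E.coord s (E.incl c * E.x ^ N)) * E.quoX (s + l) =
      E.incl c * (E.quoX (N + l) - E.quoX N * E.x ^ l) := by
  have : E.incl c * E.x ^ N = E.toA (E.C c * E.X ^ N) := by simp [incl, x]
  rw [sum_coord_mul_quoX, this, quo_low_mul_X_pow, mul_assoc, ← pow_add, quo_C_mul, quo_C_mul,
    map_sub, map_mul, map_mul, map_mul, map_pow, mul_sub, mul_assoc]
  rfl

theorem coord_x_pow (s : ℕ) {N : ℕ} (hN : N < E.n) :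
    E.coord s (E.x ^ N) = if N = s then 1 else 0 := by
  have : E.x ^ N = E.toA (E.X ^ N) := (map_pow _ _ _).symm
  rw [coord_eq_coeff_low, this, low_mk _ (E.isLow_X_pow hN)]
  simpa using E.coeff_C_mul_X_pow 1 N s

/-- `quoX_add`, multiplied by `x ^ h` and reindexed by `l = i - 1 - s`. -/
theorem quoX_mul_x_pow {j : ℕ} (hj : j < E.n) {h i : ℕ} (hi : h < i) :
    E.quoX (j + (i - 1 - h)) * E.x ^ h = ∑ l ∈ Finset.Ico (h + 1) i,
      E.incl (E.coord (E.n - 1) (E.x ^ (j + (i - 1 - l)))) * E.x ^ (l - 1) := by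
  rw [E.quoX_add hj, Finset.sum_mul]
  refine Finset.sum_nbij' (fun s => i - 1 - s) (fun l => i - 1 - l) ?_ ?_ ?_ ?_ ?_
  all_goals intro s hs
  all_goals simp only [Finset.mem_range, Finset.mem_Ico] at hs ⊢
  any_goals omega
  rw [mul_assoc, ← pow_add, show i - 1 - (i - 1 - s) = s by omega,
    show i - 1 - h - 1 - s + h = i - 1 - s - 1 by omega]

/-- The identity behind the even case: the contributions of the two kinds of cyclic permutations,
for the exponent `i`, add up to a single quotient. -/
theorem sum_quoX_telescope {j : ℕ} (hj : j < E.n) (g : ℕ → K) {i : ℕ} (hi : 1 ≤ i) :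
    ∑ l ∈ Finset.Ico 1 i, (∑ h ∈ Finset.range l,
        E.incl (g h * E.coord (E.n - 1) (E.x ^ (j + (i - 1 - l)))) * E.x ^ (l - 1) +
      E.incl (g l) * (E.quoX (j + (i - 1)) - E.quoX (j + (i - 1 - l)) * E.x ^ l)) =
    E.incl (∑ l ∈ Finset.range i, g l) * E.quoX (j + (i - 1)) := by
  have h1 : ∑ l ∈ Finset.Ico 1 i, ∑ h ∈ Finset.range l,
        E.incl (g h * E.coord (E.n - 1) (E.x ^ (j + (i - 1 - l)))) * E.x ^ (l - 1) =
      ∑ h ∈ Finset.range i, E.incl (g h) * (E.quoX (j + (i - 1 - h)) * E.x ^ h) := by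
    rw [Finset.sum_comm' (t' := Finset.range i) (s' := fun h => Finset.Ico (h + 1) i)]
    · refine Finset.sum_congr rfl fun h hh => ?_
      rw [E.quoX_mul_x_pow hj (Finset.mem_range.1 hh), Finset.mul_sum]
      exact Finset.sum_congr rfl fun l _ => by rw [map_mul, mul_assoc]
    · intro l h
      simp only [Finset.mem_range, Finset.mem_Ico]
      omega
  rw [Finset.sum_add_distrib, h1, map_sum, Finset.sum_mul, Finset.range_eq_Ico,
    ← Finset.add_sum_Ioo_eq_sum_Ico (by omega : 0 < i),
    ← Finset.add_sum_Ioo_eq_sum_Ico (by omega : 0 < i),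
    show Finset.Ioo 0 i = Finset.Ico 1 i from rfl, add_assoc, ← Finset.sum_add_distrib]
  simp only [mul_sub, Nat.sub_zero, pow_zero, mul_one, add_sub_cancel]

/-! ### The map `ψ` on tensors of powers of `x` with one arbitrary factor -/

/-- A scalar at the factor `q + 1` can be moved to the factor `0` across factors which commute with
scalars up to powers of `α`. -/
theorem hcls_update_incl_mul {r : ℕ} (t : Fin r → E.A) (e : ℕ → ℕ) (q : Fin r)
    (ht : ∀ p : Fin r, p < q → ∀ c, t p * E.incl c = E.incl ((E.α ^ e p) c) * t p)
    (a b : E.A) (c : K) :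
    E.hcls r (Fin.cons a (Function.update t q (E.incl c * b))) =
      E.hcls r (Fin.cons (a * E.incl ((E.α ^ ∑ p ∈ Finset.range q, e p) c))
        (Function.update t q b)) := by
  set w : Fin (r + 1) → E.A := Fin.cons a (Function.update t q b) with hw
  have claim : ∀ p (hp : p ≤ q.val) (c : K),
      E.hcls r (Function.update w ⟨p, by omega⟩ (w ⟨p, by omega⟩ * E.incl c)) =
        E.hcls r (Function.update w 0 (a * E.incl ((E.α ^ ∑ i ∈ Finset.range p, e i) c))) := by
    intro p
    induction p with
    | zero =>
      intro _ c
      have : w 0 = a := rfl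
      simp [this]
    | succ p ih =>
      intro hp c
      have hp' : p < r := by omega
      have h0 : w ⟨p + 1, by omega⟩ = t ⟨p, hp'⟩ := by
        change w (Fin.succ ⟨p, hp'⟩) = _
        rw [hw, Fin.cons_succ, Function.update_of_ne]
        intro h
        have := congrArg Fin.val h
        simp at this
        omega
      have h1 : w ⟨p + 1, by omega⟩ * E.incl c =
          E.incl ((E.α ^ e p) c) * w ⟨p + 1, by omega⟩ := by
        rw [h0]
        exact ht ⟨p, hp'⟩ (by rw [Fin.lt_def]; exact hp) c
      have h2 : (⟨p + 1, by omega⟩ : Fin (r + 1)) = ⟨p, by omega⟩ + 1 :=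
        (Fin.coeSucc_eq_succ (a := (⟨p, hp'⟩ : Fin r))).symm
      rw [h1, h2, ← E.hcls_balance, ih (by omega), ← AlgHom.mul_apply, ← pow_add,
        Finset.sum_range_succ]
  have h1 := claim q le_rfl c
  have h2 : (⟨q, by omega⟩ : Fin (r + 1)) = q.castSucc := rfl
  rw [h2, E.hcls_balance, Fin.coeSucc_eq_succ] at h1
  simpa only [hw, Fin.cons_succ, Function.update_self, ← Fin.cons_update, Function.update_idem,
    Fin.update_cons_zero] using h1

theorem quoProd_congr {m : ℕ} {i j : ℕ → ℕ} (h : ∀ t < 2 * m, i t = j t) :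
    E.quoProd m i = E.quoProd m j := by
  refine congrArg List.prod (List.map_congr_left fun t ht => ?_)
  have := List.mem_range.1 ht
  rw [h _ (by omega), h _ (by omega)]

theorem psiMono_apply_of_even {r : ℕ} (hr : r % 2 = 0) (i : ℕ → ℕ) (a : E.A) :
    E.psiMono r i a = E.cls r (a * E.quoProd (r / 2) i) :=
  if_pos hr

theorem psiMono_apply_of_odd {r : ℕ} (hr : r % 2 = 1) (i : ℕ → ℕ) (a : E.A) :
    E.psiMono r i a = ∑ l ∈ Finset.range (i (r - 1)),
      E.cls r (E.x ^ (i (r - 1) - l - 1) * a * E.quoProd (r / 2) i * E.x ^ l) :=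
  if_neg (by omega)

theorem psiMono_congr {r : ℕ} {i j : ℕ → ℕ} (h : ∀ t < r, i t = j t) (a : E.A) :
    E.psiMono r i a = E.psiMono r j a := by
  have hQ : E.quoProd (r / 2) i = E.quoProd (r / 2) j :=
    E.quoProd_congr fun t ht => h t (by omega)
  rcases Nat.mod_two_eq_zero_or_one r with hr | hr
  · rw [psiMono_apply_of_even _ hr, psiMono_apply_of_even _ hr, hQ]
  · rw [psiMono_apply_of_odd _ hr, psiMono_apply_of_odd _ hr, hQ, h (r - 1) (by omega)]

/-- `ψ` at a tensor whose first factor is `1` and whose other factors are powers of `x`, except for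
an arbitrary one: expand the latter in the basis of powers of `x` and move its coordinates to the
front. -/
theorem psi_update {r : ℕ} (e : ℕ → ℕ) (he : ∀ t < r, e t < E.n) (q : Fin r) (b : E.A) :
    E.psi r (E.hcls r (Fin.cons 1 (Function.update (fun t : Fin r => E.x ^ e t) q b))) =
      ∑ s ∈ Finset.range E.n, E.psiMono r (Function.update e q s)
        (E.incl ((E.α ^ ∑ t ∈ Finset.range q, e t) (E.coord s b))) := by
  have hlin : ∀ b, E.hcls r (Fin.cons 1 (Function.update (fun t : Fin r => E.x ^ e t) q b)) =
      (E.hcls r).toLinearMap (Fin.cons 1 fun t : Fin r => E.x ^ e t) q.succ b := by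
    intro b
    rw [MultilinearMap.toLinearMap_apply, Fin.cons_update]
  conv_lhs => rw [hlin, E.eq_sum_coord b, map_sum, map_sum]
  refine Finset.sum_congr rfl fun s hs => ?_
  rw [← hlin, E.hcls_update_incl_mul _ e q (fun p _ c => E.x_pow_mul_incl _ _), one_mul]
  have h1 : Function.update (fun t : Fin r => E.x ^ e t) q (E.x ^ s) =
      fun t : Fin r => E.x ^ (Function.update e q s t) := by
    funext t
    rcases eq_or_ne t q with rfl | h
    · simp
    · rw [Function.update_of_ne h, Function.update_of_ne (fun h' => h (Fin.ext h'))]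
  rw [h1, E.psi_monomial r _ fun t : Fin r => Function.update e q s t]
  · exact E.psiMono_congr (fun t ht => by simp [extend, ht]) _
  · intro t
    rcases eq_or_ne t q with rfl | h
    · simpa using hs
    · rw [Function.update_of_ne (fun h' => h (Fin.ext h'))]
      exact he t t.isLt

/-! ### The rotations of the terms of `φ` -/

/-- The exponents of `phiTail`, at the positions `p ≥ 1` of the whole tensor. -/
def tailExp (r : ℕ) (l : Fin (r / 2) → ℕ) (p : ℕ) : ℕ :=
  if p % 2 = 0 then extend l (r / 2 - p / 2) else 1

/-- The exponents of the cyclic permutation of `b ⊗ phiTail r l` which brings `b` to the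
position `q`; the value at `q` itself is irrelevant. -/
def rotExp (r : ℕ) (l : Fin (r / 2) → ℕ) (q t : ℕ) : ℕ :=
  tailExp r l (if t < q then r + 1 + t - q else t - q)

theorem phiTail_eq (r : ℕ) (l : Fin (r / 2) → ℕ) (p : Fin r) :
    E.phiTail r l p = E.x ^ tailExp r l (p + 1) := by
  unfold phiTail tailExp
  split_ifs with h1 h2 h2
  · have hp := p.isLt
    have : r / 2 - (p.val + 1) / 2 < r / 2 := by omega
    rw [extend, dif_pos this]
    congr 2
    ext
    simp only [Fin.val_rev]
    omega
  · omega
  · omega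
  · simp

theorem rotOne_phiTail (r : ℕ) (l : Fin (r / 2) → ℕ) (q : Fin (r + 1)) (b : E.A) :
    E.rotOne r (-q) (Fin.cons b (E.phiTail r l)) =
      E.hcls (r + 1) (Fin.cons 1
        (Function.update (fun t : Fin (r + 1) => E.x ^ rotExp r l q t) q b)) := by
  rw [rotOne_apply]
  congr 2
  funext t
  rcases eq_or_ne t q with rfl | h
  · simp
  · rw [Function.update_of_ne h]
    have hne : -q + t ≠ 0 := by
      intro h'
      exact h (neg_add_eq_zero.1 h').symm
    obtain ⟨p, hp⟩ := Fin.exists_succ_eq.2 hne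
    rw [← hp, Fin.cons_succ, phiTail_eq, rotExp]
    congr 2
    have h1 : p.val + 1 = (-q + t).val := by rw [← hp]; rfl
    have hq := q.isLt
    have ht := t.isLt
    have h2 : t.val ≠ q.val := fun h' => h (Fin.ext h')
    rw [h1, neg_add_eq_sub, Fin.val_sub]
    split_ifs with h3
    · rw [Nat.mod_eq_of_lt (by omega)]; omega
    · rw [show r + 1 - q.val + t.val = (t - q) + (r + 1) by omega, Nat.add_mod_right,
        Nat.mod_eq_of_lt (by omega)]

/-- The sign of the cyclic permutation by `-q`: the exponents for `q` and `-q` add up to `0` or to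
the even number `r * (r + 1)`. -/
theorem neg_one_pow_neg_val (r : ℕ) (q : Fin (r + 1)) :
    (-1 : k) ^ ((-q).val * r) = (-1) ^ (q.val * r) := by
  have h : (-q).val * r % 2 = q.val * r % 2 := by
    rcases eq_or_ne q 0 with rfl | h0
    · simp
    · have hq := q.isLt
      have h0' : q.val ≠ 0 := fun h => h0 (Fin.ext h)
      have h1 : (-q).val = r + 1 - q.val := by
        rw [Fin.val_neg', Nat.mod_eq_of_lt (by omega)]
      have h2 : (-q).val * r + q.val * r = r * (r + 1) := by
        rw [h1, ← add_mul, Nat.sub_add_cancel hq.le, mul_comm]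
      have h3 := (Nat.even_mul_succ_self r).two_dvd
      omega
  rw [neg_one_pow_eq_pow_mod_two, h, ← neg_one_pow_eq_pow_mod_two]

/-- The coefficient factor `lam_{n-i_1} ⋯ lam_{n-i_m} a x^{|i-l|-m}` in the terms of `φ_r [a]`. -/
def phiHead (r : ℕ) (i l : Fin (r / 2) → ℕ) (a : E.A) : E.A :=
  E.incl (List.ofFn fun t => E.lam (E.n - i t)).prod * a * E.x ^ (∑ t, (i t - l t) - r / 2)

/-- The value of `ψ` at the tensor `1 ⊗ x^{e 0} ⊗ ⋯ ⊗ b ⊗ ⋯ ⊗ x^{e r}`, with `b` at the factor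
`q + 1` and `e = rotExp r l q`. -/
def rotVal (r : ℕ) (l : Fin (r / 2) → ℕ) (q : ℕ) (b : E.A) : E.CS (r + 1) :=
  ∑ s ∈ Finset.range E.n, E.psiMono (r + 1) (Function.update (rotExp r l q) q s)
    (E.incl ((E.α ^ ∑ t ∈ Finset.range q, rotExp r l q t) (E.coord s b)))

/-- `D_r [a]` as a sum over the position `q` of the coefficient factor after the cyclic permutation
by `-q`, and over the terms of `φ_r`. -/
theorem D_cls (r : ℕ) (a : E.A) :
    E.D r (E.cls r a) = ∑ q ∈ Finset.range (r + 1), (-1 : k) ^ (q * r) •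
      ∑ i ∈ Fintype.piFinset fun _ : Fin (r / 2) => Finset.Icc 1 E.n,
        ∑ l ∈ Fintype.piFinset fun t : Fin (r / 2) => Finset.Ico 1 (i t),
          E.rotVal r l q (E.phiHead r i l a) := by
  have h1 : E.phi r (E.cls r a) = E.phiSum r a := rfl
  change E.psi (r + 1) (E.B r (E.phi r (E.cls r a))) = _
  rw [h1, phiSum]
  simp only [LinearMap.sum_apply, map_sum, Finset.smul_sum]
  rw [Finset.sum_comm]
  refine Finset.sum_congr rfl fun i hi => ?_
  rw [Finset.sum_comm]
  refine Finset.sum_congr rfl fun l hl => ?_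
  simp only [Fintype.mem_piFinset, Finset.mem_Icc, Finset.mem_Ico] at hi hl
  have h2 := E.two_le
  have hlt : ∀ q t, rotExp r l q t < E.n := by
    intro q t
    unfold rotExp tailExp
    generalize (if t < q then r + 1 + t - q else t - q) = p
    split_ifs
    · unfold extend
      split_ifs with h
      · have := hl ⟨_, h⟩
        have := hi ⟨_, h⟩
        omega
      · omega
    · omega
  change E.psi (r + 1) (E.B r (E.hcls r (Fin.cons (E.phiHead r i l a) (E.phiTail r l)))) = _
  rw [B, hochLift_hcls, sum_apply, map_sum, Finset.sum_range,
    ← Equiv.sum_comp (Equiv.neg (Fin (r + 1)))]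
  -- The summand for the index `-q` has the coefficient factor at the position `q`.
  refine Finset.sum_congr rfl fun q _ => ?_
  rw [Equiv.neg_apply, smul_apply, map_smul, neg_one_pow_neg_val, rotOne_phiTail,
    E.psi_update _ (fun t _ => hlt q t)]
  rfl

/-! ### Collapsing the sums over the exponents -/

/-- If only the terms with all `l t = n - 1` survive, then `i t = n` as well, since
`l t < i t ≤ n`. -/
theorem sum_piFinset_eq_single {V : Type*} [AddCommMonoid V] {M n : ℕ} (hn : 2 ≤ n)
    (F : (Fin M → ℕ) → (Fin M → ℕ) → V)
    (hF : ∀ i l, (∀ t, l t < i t ∧ i t ≤ n) → (∃ t, l t ≠ n - 1) → F i l = 0) :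
    ∑ i ∈ Fintype.piFinset fun _ : Fin M => Finset.Icc 1 n,
      ∑ l ∈ Fintype.piFinset fun t : Fin M => Finset.Ico 1 (i t), F i l =
    F (fun _ => n) (fun _ => n - 1) := by
  rw [Finset.sum_sigma']
  refine (Finset.sum_eq_single
    (⟨fun _ => n, fun _ => n - 1⟩ : (_ : Fin M → ℕ) × (Fin M → ℕ)) ?_ ?_)
  · rintro ⟨i, l⟩ h hne
    simp only [Finset.mem_sigma, Fintype.mem_piFinset, Finset.mem_Icc, Finset.mem_Ico] at h
    refine hF i l (fun t => ⟨(h.2 t).2, (h.1 t).2⟩) ?_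
    by_contra! hc
    refine hne ?_
    obtain rfl : l = fun _ => n - 1 := funext hc
    obtain rfl : i = fun _ => n := funext fun t => by
      have := h.1 t; have := (h.2 t).2; dsimp only at this; omega
    rfl
  · intro h
    refine absurd ?_ h
    simp only [Finset.mem_sigma, Fintype.mem_piFinset, Finset.mem_Icc, Finset.mem_Ico]
    exact ⟨fun _ => by omega, fun _ => by omega⟩

/-- If only the terms with `l t = n - 1` for all `t ≠ t₀` survive, the sum runs over `i t₀` and
`l t₀` alone. -/
theorem sum_piFinset_eq_sum_update {V : Type*} [AddCommMonoid V] {M n : ℕ} (hn : 2 ≤ n)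
    (t₀ : Fin M) (F : (Fin M → ℕ) → (Fin M → ℕ) → V)
    (hF : ∀ i l, (∀ t, l t < i t ∧ i t ≤ n) → (∃ t, t ≠ t₀ ∧ l t ≠ n - 1) → F i l = 0) :
    ∑ i ∈ Fintype.piFinset fun _ : Fin M => Finset.Icc 1 n,
      ∑ l ∈ Fintype.piFinset fun t : Fin M => Finset.Ico 1 (i t), F i l =
    ∑ i ∈ Finset.Icc 1 n, ∑ l ∈ Finset.Ico 1 i,
      F (Function.update (fun _ => n) t₀ i) (Function.update (fun _ => n - 1) t₀ l) := by
  rw [Finset.sum_sigma', Finset.sum_sigma']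
  symm
  refine Finset.sum_of_injOn (fun s => ⟨Function.update (fun _ => n) t₀ s.1,
    Function.update (fun _ => n - 1) t₀ s.2⟩) ?_ ?_ ?_ (fun _ _ => rfl)
  · rintro ⟨i, l⟩ _ ⟨i', l'⟩ _ h
    simp only [Sigma.mk.injEq, heq_eq_eq] at h
    have h1 := congrFun h.1 t₀
    have h2 := congrFun h.2 t₀
    simp only [Function.update_self] at h1 h2
    rw [h1, h2]
  · rintro ⟨i, l⟩ h
    simp only [Finset.coe_sigma, Set.mem_sigma_iff, Finset.mem_coe, Fintype.mem_piFinset,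
      Finset.mem_Icc, Finset.mem_Ico] at h ⊢
    constructor
    · intro t
      rcases eq_or_ne t t₀ with rfl | ht
      · simpa using h.1
      · simp only [Function.update_of_ne ht]; omega
    · intro t
      rcases eq_or_ne t t₀ with rfl | ht
      · simpa using h.2
      · simp only [Function.update_of_ne ht]; omega
  · rintro ⟨i, l⟩ h hne
    simp only [Finset.mem_sigma, Fintype.mem_piFinset, Finset.mem_Icc, Finset.mem_Ico] at h
    refine hF i l (fun t => ⟨(h.2 t).2, (h.1 t).2⟩) ?_
    by_contra! hc
    refine hne ⟨⟨i t₀, l t₀⟩, ?_, ?_⟩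
    · simpa using ⟨h.1 t₀, h.2 t₀⟩
    · have e1 : Function.update (fun _ => n) t₀ (i t₀) = i := by
        funext t
        rcases eq_or_ne t t₀ with rfl | ht
        · simp
        · rw [Function.update_of_ne ht]
          have := h.1 t; have := h.2 t; have := hc t ht; omega
      have e2 : Function.update (fun _ => n - 1) t₀ (l t₀) = l := by
        funext t
        rcases eq_or_ne t t₀ with rfl | ht
        · simp
        · rw [Function.update_of_ne ht, hc t ht]
      simp only [e1, e2]

theorem prod_ofFn_update_one {M : Type*} [Monoid M] {N : ℕ} (t : Fin N) (y : M) :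
    (List.ofFn (Function.update (fun _ => 1) t y)).prod = y := by
  induction N with
  | zero => exact t.elim0
  | succ N ih =>
    rw [List.ofFn_succ, List.prod_cons]
    induction t using Fin.cases with
    | zero => simp
    | succ t =>
      have h : (fun p : Fin N => Function.update (fun _ => (1 : M)) t.succ y p.succ) =
          Function.update (fun _ => 1) t y := by
        funext p
        rcases eq_or_ne p t with rfl | hp
        · simp
        · rw [Function.update_of_ne hp, Function.update_of_ne (by simpa using hp)]
      rw [h, ih, Function.update_of_ne (Fin.succ_ne_zero t).symm, one_mul]

theorem phiHead_const (r : ℕ) (a : E.A) :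
    E.phiHead r (fun _ => E.n) (fun _ => E.n - 1) a = a := by
  have h2 := E.two_le
  have h : E.n - (E.n - 1) = 1 := by omega
  simp [phiHead, E.lam_zero, h]

theorem phiHead_update (r : ℕ) (t₀ : Fin (r / 2)) {i l : ℕ} (hl : l < i) (c : K) (j : ℕ) :
    E.phiHead r (Function.update (fun _ => E.n) t₀ i) (Function.update (fun _ => E.n - 1) t₀ l)
      (E.incl c * E.x ^ j) = E.incl (E.lam (E.n - i) * c) * E.x ^ (j + (i - 1 - l)) := by
  have h2 := E.two_le
  have h1 : (fun t => E.lam (E.n - Function.update (fun _ => E.n) t₀ i t)) =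
      Function.update (fun _ : Fin (r / 2) => 1) t₀ (E.lam (E.n - i)) := by
    funext t
    rcases eq_or_ne t t₀ with rfl | ht
    · simp
    · simp [Function.update_of_ne ht, E.lam_zero]
  have h3 : ∀ t, Function.update (fun _ => E.n) t₀ i t -
      Function.update (fun _ => E.n - 1) t₀ l t =
        Function.update (fun _ : Fin (r / 2) => 1) t₀ (i - l) t := by
    intro t
    rcases eq_or_ne t t₀ with rfl | ht
    · simp
    · simp only [Function.update_of_ne ht]; omega
  have h4 : ∑ t, Function.update (fun _ : Fin (r / 2) => 1) t₀ (i - l) t - r / 2 =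
      i - 1 - l := by
    have := t₀.isLt
    rw [Finset.sum_update_of_mem (Finset.mem_univ _)]
    simp only [Finset.sum_const, smul_eq_mul, mul_one, Finset.card_sdiff, Finset.card_univ,
      Fintype.card_fin]
    simp
    omega
  rw [phiHead, h1, prod_ofFn_update_one, Finset.sum_congr rfl fun t _ => h3 t, h4, map_mul, pow_add]
  simp only [mul_assoc]

/-! ### The values of `ψ` at the rotations -/

/-- A pair of factors not containing the position `q` consists of `x` and one power `x ^ (l t)`, in
one order or the other. The right-hand side tells which `t` it is. -/
theorem rotExp_pair {r : ℕ} (l : Fin (r / 2) → ℕ) {q v : ℕ} (hq : q ≤ r) (hv : v < (r + 1) / 2)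
    (hne : v ≠ q / 2) :
    rotExp r l q (2 * v) + rotExp r l q (2 * v + 1) =
      extend l (if q / 2 < v then r / 2 - v + q / 2 else
        if r % 2 = 0 ∧ q % 2 = 1 then q / 2 - v else q / 2 - v - 1) + 1 := by
  have hodd : ∀ p, p % 2 = 1 → tailExp r l p = 1 := fun p hp => if_neg (by omega)
  have heven : ∀ p w, p % 2 = 0 → r / 2 - p / 2 = w → tailExp r l p = extend l w :=
    fun p w hp hw => by rw [tailExp, if_pos hp, hw]
  unfold rotExp
  rcases Nat.lt_or_gt_of_ne hne with h | h
  · rw [if_neg (show ¬ q / 2 < v by omega), if_pos (show 2 * v < q by omega),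
      if_pos (show 2 * v + 1 < q by omega)]
    split_ifs with h1
    · rw [heven (r + 1 + 2 * v - q) (q / 2 - v) (by omega) (by omega), hodd _ (by omega)]
    · rcases Nat.mod_two_eq_zero_or_one (r + 1 - q) with h2 | h2
      · rw [heven (r + 1 + 2 * v - q) (q / 2 - v - 1) (by omega) (by omega), hodd _ (by omega)]
      · rw [hodd _ (by omega), heven _ (q / 2 - v - 1) (by omega) (by omega), add_comm]
  · rw [if_pos h, if_neg (show ¬ 2 * v < q by omega), if_neg (show ¬ 2 * v + 1 < q by omega)]
    rcases Nat.mod_two_eq_zero_or_one q with h2 | h2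
    · rw [heven (2 * v - q) (r / 2 - v + q / 2) (by omega) (by omega), hodd _ (by omega)]
    · rw [hodd _ (by omega), heven _ (r / 2 - v + q / 2) (by omega) (by omega), add_comm]

/-- Every index `t` occurs in some pair of factors consisting of `x` and `x ^ (l t)`, except,
for even `r`, the index of the last factor if `q` is even and `q < r`, and the index paired with
the coefficient if `q` is odd. The quotient of `x ^ (l t + 1)` by `f` vanishes if `l t + 1 < n`. -/
theorem rotVal_eq_zero {r : ℕ} {l : Fin (r / 2) → ℕ} {q : ℕ} (hq : q ≤ r) (b : E.A)
    (t : Fin (r / 2)) (hl : l t + 1 < E.n)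
    (ht : r % 2 = 0 → t.val ≠ if q % 2 = 0 then q / 2 else 0) :
    E.rotVal r l q b = 0 := by
  obtain ⟨v, hv, hne, hvt⟩ : ∃ v, v < (r + 1) / 2 ∧ v ≠ q / 2 ∧
      (if q / 2 < v then r / 2 - v + q / 2 else
        if r % 2 = 0 ∧ q % 2 = 1 then q / 2 - v else q / 2 - v - 1) = t.val := by
    have := t.isLt
    by_cases h : r % 2 = 0 ∧ q % 2 = 1
    · have ht' := ht h.1
      rw [if_neg (by omega)] at ht'
      simp only [if_pos h]
      by_cases h1 : t.val ≤ q / 2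
      · exact ⟨q / 2 - t, by omega, by omega, by rw [if_neg (by omega)]; omega⟩
      · exact ⟨r / 2 + q / 2 - t, by omega, by omega, by rw [if_pos (by omega)]; omega⟩
    · simp only [if_neg h]
      have ht' : r % 2 = 0 → t.val ≠ q / 2 := fun h' => by
        have := ht h'
        rwa [if_pos (by omega)] at this
      by_cases h1 : t.val < q / 2
      · exact ⟨q / 2 - 1 - t, by omega, by omega, by rw [if_neg (by omega)]; omega⟩
      · exact ⟨r / 2 + q / 2 - t, by omega, by omega, by rw [if_pos (by omega)]; omega⟩
  have hsum := rotExp_pair l hq hv hne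
  rw [hvt, extend, dif_pos t.isLt] at hsum
  refine Finset.sum_eq_zero fun s _ => ?_
  have hQ : E.quoProd ((r + 1) / 2) (Function.update (rotExp r l q) q s) = 0 := by
    refine E.quoProd_eq_zero hv ?_
    rw [Function.update_of_ne (by omega), Function.update_of_ne (by omega), hsum]
    exact hl
  rcases Nat.mod_two_eq_zero_or_one (r + 1) with hr | hr
  · rw [psiMono_apply_of_even _ hr, hQ, mul_zero, map_zero]
  · simp [psiMono_apply_of_odd _ hr, hQ]

theorem rotExp_pair_eq {r : ℕ} {l : Fin (r / 2) → ℕ} {q : ℕ} (hq : q ≤ r)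
    (hl : ∀ t : Fin (r / 2), (r % 2 = 0 → t.val ≠ if q % 2 = 0 then q / 2 else 0) →
      l t = E.n - 1) {v : ℕ} (hv : v < (r + 1) / 2) (hne : v ≠ q / 2) :
    rotExp r l q (2 * v) + rotExp r l q (2 * v + 1) = E.n := by
  have h2 := E.two_le
  rw [rotExp_pair l hq hv hne]
  set w := (if q / 2 < v then r / 2 - v + q / 2 else
        if r % 2 = 0 ∧ q % 2 = 1 then q / 2 - v else q / 2 - v - 1) with hw
  have hwlt : w < r / 2 := by
    rw [hw]; split_ifs <;> omega
  have : l ⟨w, hwlt⟩ = E.n - 1 := by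
    refine hl _ fun hr => ?_
    change w ≠ _
    rw [hw]
    split_ifs <;> omega
  rw [extend, dif_pos hwlt, this]
  omega

/-- The exponent of the twist of a scalar moved from the position `q` to the front: every complete
pair contributes `n`. -/
theorem sum_range_rotExp {r : ℕ} {l : Fin (r / 2) → ℕ} {q : ℕ} (hq : q ≤ r)
    (hl : ∀ t : Fin (r / 2), (r % 2 = 0 → t.val ≠ if q % 2 = 0 then q / 2 else 0) →
      l t = E.n - 1) :
    ∑ t ∈ Finset.range q, rotExp r l q t = E.n * (q / 2) + q % 2 * rotExp r l q (q - 1) := by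
  rw [sum_pairs, Finset.sum_congr rfl fun v hv => E.rotExp_pair_eq hq hl (v := v)
    (by have := Finset.mem_range.1 hv; omega) (by have := Finset.mem_range.1 hv; omega)]
  simp [mul_comm]

theorem quoProd_succ (m : ℕ) (i : ℕ → ℕ) :
    E.quoProd (m + 1) i = E.quoProd m i * E.quoX (i (2 * m) + i (2 * m + 1)) := by
  simp [quoProd, quoX, List.range_succ]

theorem quoProd_eq_one {m : ℕ} {i : ℕ → ℕ} (h : ∀ v < m, i (2 * v) + i (2 * v + 1) = E.n) :
    E.quoProd m i = 1 := by
  induction m with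
  | zero => simp [quoProd]
  | succ m ih =>
    rw [quoProd_succ, h m (by omega), quoX_n, mul_one, ih fun v hv => h v (by omega)]

theorem quoProd_eq_quoX {m w : ℕ} {i : ℕ → ℕ} (hw : w < m)
    (h : ∀ v < m, v ≠ w → i (2 * v) + i (2 * v + 1) = E.n) :
    E.quoProd m i = E.quoX (i (2 * w) + i (2 * w + 1)) := by
  induction m with
  | zero => omega
  | succ m ih =>
    rw [quoProd_succ]
    rcases Nat.lt_succ_iff_lt_or_eq.1 hw with h' | rfl
    · rw [h m (by omega) (by omega), quoX_n, mul_one, ih h' fun v hv => h v (by omega)]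
    · rw [E.quoProd_eq_one fun v hv => h v (by omega) (by omega), one_mul]

theorem quoProd_update_rotExp {r : ℕ} {l : Fin (r / 2) → ℕ} {q : ℕ} (hq : q < (r + 1) / 2 * 2)
    (hl : ∀ t : Fin (r / 2), (r % 2 = 0 → t.val ≠ if q % 2 = 0 then q / 2 else 0) →
      l t = E.n - 1) (s : ℕ) :
    E.quoProd ((r + 1) / 2) (Function.update (rotExp r l q) q s) =
      E.quoX (s + if q % 2 = 0 then rotExp r l q (q + 1) else rotExp r l q (q - 1)) := by
  rw [E.quoProd_eq_quoX (w := q / 2) (by omega)]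
  · congr 1
    split_ifs with h
    · rw [show 2 * (q / 2) = q by omega, Function.update_self, Function.update_of_ne (by omega)]
    · rw [show 2 * (q / 2) + 1 = q by omega, show 2 * (q / 2) = q - 1 by omega,
        Function.update_self, Function.update_of_ne (by omega), add_comm]
  · intro v hv hne
    rw [Function.update_of_ne (by omega), Function.update_of_ne (by omega)]
    exact E.rotExp_pair_eq (by omega) hl hv hne

/-- For odd `r`, the coefficient is paired with `x` at every position `q`. -/
theorem rotVal_of_odd {r : ℕ} (hr : r % 2 = 1) {l : Fin (r / 2) → ℕ} (hl : ∀ t, l t = E.n - 1)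
    {q : ℕ} (hq : q ≤ r) (b : E.A) :
    E.rotVal r l q b =
      E.cls (r + 1) (E.incl ((E.α ^ (E.n * (q / 2) + q % 2)) (E.coord (E.n - 1) b))) := by
  have hlast : 0 < q → q % 2 = 1 → rotExp r l q (q - 1) = 1 := fun h0 h => by
    rw [rotExp, if_pos (by omega), tailExp, if_neg (by omega)]
  have hnext : q % 2 = 0 → rotExp r l q (q + 1) = 1 := fun h => by
    rw [rotExp, if_neg (by omega), tailExp, if_neg (by omega)]
  have e1 : ∑ t ∈ Finset.range q, rotExp r l q t = E.n * (q / 2) + q % 2 := by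
    rw [E.sum_range_rotExp hq fun t _ => hl t]
    rcases Nat.mod_two_eq_zero_or_one q with h | h
    · simp [h]
    · rw [hlast (by omega) h, mul_one]
  have e2 : ∀ s, E.quoProd ((r + 1) / 2) (Function.update (rotExp r l q) q s) =
      E.quoX (s + 1) := by
    intro s
    rw [E.quoProd_update_rotExp (by omega) fun t _ => hl t]
    split_ifs with h
    · rw [hnext h]
    · rw [hlast (by omega) (by omega)]
  simp only [rotVal, E.psiMono_apply_of_even (show (r + 1) % 2 = 0 by omega), e1, e2]
  rw [← map_sum, E.sum_incl_mul_quoX_succ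
    fun s => (E.α ^ (E.n * (q / 2) + q % 2)) (E.coord s b)]

/-- For even `r` and `q = 2 w < r`, the coefficient is paired with `x` and `x ^ (l w)` is the last
factor. -/
theorem rotVal_of_even_two_mul {r : ℕ} (hr : r % 2 = 0) {l : Fin (r / 2) → ℕ} {w : ℕ}
    (hw : w < r / 2) (hl : ∀ t : Fin (r / 2), t.val ≠ w → l t = E.n - 1) (b : E.A) :
    E.rotVal r l (2 * w) b =
      ∑ h ∈ Finset.range (l ⟨w, hw⟩), E.cls (r + 1) (E.x ^ (l ⟨w, hw⟩ - h - 1) *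
        E.incl ((E.α ^ (E.n * w)) (E.coord (E.n - 1) b)) * E.x ^ h) := by
  have hl' : ∀ t : Fin (r / 2), (r % 2 = 0 →
      t.val ≠ if 2 * w % 2 = 0 then 2 * w / 2 else 0) → l t = E.n - 1 := fun t ht =>
    hl t (by have := ht hr; rwa [if_pos (by omega), Nat.mul_div_cancel_left _ two_pos] at this)
  have e1 : ∑ t ∈ Finset.range (2 * w), rotExp r l (2 * w) t = E.n * w := by
    rw [E.sum_range_rotExp (by omega) hl']
    simp
  have e2 : ∀ s, E.quoProd ((r + 1) / 2) (Function.update (rotExp r l (2 * w)) (2 * w) s) =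
      E.quoX (s + 1) := by
    intro s
    rw [E.quoProd_update_rotExp (by omega) hl', if_pos (by omega), rotExp, if_neg (by omega),
      tailExp, if_neg (by omega)]
  have e3 : ∀ s, Function.update (rotExp r l (2 * w)) (2 * w) s (r + 1 - 1) = l ⟨w, hw⟩ := by
    intro s
    rw [Function.update_of_ne (by omega), rotExp, if_neg (by omega), tailExp, if_pos (by omega),
      show r / 2 - (r + 1 - 1 - 2 * w) / 2 = w by omega, extend, dif_pos hw]
  simp only [rotVal, E.psiMono_apply_of_odd (show (r + 1) % 2 = 1 by omega), e1, e2, e3]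
  rw [Finset.sum_comm]
  refine Finset.sum_congr rfl fun h _ => ?_
  rw [← map_sum, ← Finset.sum_mul]
  simp only [mul_assoc (E.x ^ (l ⟨w, hw⟩ - h - 1))]
  rw [← Finset.mul_sum, E.sum_incl_mul_quoX_succ fun s => (E.α ^ (E.n * w)) (E.coord s b),
    mul_assoc]

/-- For even `r` and `q = 2 w + 1`, the coefficient is paired with `x ^ (l 0)` and the last factor
is `x`. -/
theorem rotVal_of_even_two_mul_add_one {r : ℕ} (hr : r % 2 = 0) {l : Fin (r / 2) → ℕ} {w : ℕ}
    (hw : w < r / 2) (hl : ∀ t : Fin (r / 2), t.val ≠ 0 → l t = E.n - 1) (b : E.A) :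
    E.rotVal r l (2 * w + 1) b = E.cls (r + 1) (∑ s ∈ Finset.range E.n,
      E.incl ((E.α ^ (E.n * w + l ⟨0, by omega⟩)) (E.coord s b)) *
        E.quoX (s + l ⟨0, by omega⟩)) := by
  have hl' : ∀ t : Fin (r / 2), (r % 2 = 0 →
      t.val ≠ if (2 * w + 1) % 2 = 0 then (2 * w + 1) / 2 else 0) → l t = E.n - 1 := fun t ht =>
    hl t (by have := ht hr; rwa [if_neg (by omega)] at this)
  have hlast : rotExp r l (2 * w + 1) (2 * w + 1 - 1) = l ⟨0, by omega⟩ := by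
    rw [rotExp, if_pos (by omega), tailExp, if_pos (by omega),
      show r / 2 - (r + 1 + (2 * w + 1 - 1) - (2 * w + 1)) / 2 = 0 by omega, extend,
      dif_pos (by omega)]
  have e1 : ∑ t ∈ Finset.range (2 * w + 1), rotExp r l (2 * w + 1) t =
      E.n * w + l ⟨0, by omega⟩ := by
    rw [E.sum_range_rotExp (by omega) hl', hlast, show (2 * w + 1) / 2 = w by omega,
      show (2 * w + 1) % 2 = 1 by omega, one_mul]
  have e2 : ∀ s, E.quoProd ((r + 1) / 2)
      (Function.update (rotExp r l (2 * w + 1)) (2 * w + 1) s) =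
      E.quoX (s + l ⟨0, by omega⟩) := by
    intro s
    rw [E.quoProd_update_rotExp (by omega) hl', if_neg (by omega), hlast]
  have e3 : ∀ s, Function.update (rotExp r l (2 * w + 1)) (2 * w + 1) s (r + 1 - 1) = 1 := by
    intro s
    rw [Function.update_of_ne (by omega), rotExp, if_neg (by omega), tailExp, if_neg (by omega)]
  simp only [rotVal, E.psiMono_apply_of_odd (show (r + 1) % 2 = 1 by omega), e1, e2, e3]
  simp

/-- For even `r` and `q = r`, the coefficient is the last factor. -/
theorem rotVal_of_even_self {r : ℕ} (hr : r % 2 = 0) {l : Fin (r / 2) → ℕ}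
    (hl : ∀ t, l t = E.n - 1) {j : ℕ} (hj : j < E.n) (c : K) :
    E.rotVal r l r (E.incl c * E.x ^ j) = E.cls (r + 1)
      (E.incl (∑ h ∈ Finset.range j, (E.α ^ (r / 2 * E.n + h)) c) * E.x ^ (j - 1)) := by
  have e1 : ∑ t ∈ Finset.range r, rotExp r l r t = r / 2 * E.n := by
    rw [E.sum_range_rotExp le_rfl fun t _ => hl t, hr, mul_comm]
    simp
  have e2 : ∀ s, E.quoProd ((r + 1) / 2) (Function.update (rotExp r l r) r s) = 1 := by
    intro s
    refine E.quoProd_eq_one fun v hv => ?_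
    rw [Function.update_of_ne (by omega), Function.update_of_ne (by omega)]
    exact E.rotExp_pair_eq le_rfl (fun t _ => hl t) hv (by omega)
  simp only [rotVal, E.psiMono_apply_of_odd (show (r + 1) % 2 = 1 by omega), e1, e2,
    Nat.add_sub_cancel, Function.update_self]
  rw [Finset.sum_eq_single j]
  · rw [coord_incl_mul, E.coord_x_pow _ hj, if_pos rfl, mul_one, map_sum E.incl, Finset.sum_mul,
      map_sum (E.cls (r + 1))]
    conv_rhs => rw [← Finset.sum_range_reflect]
    refine Finset.sum_congr rfl fun h hh => ?_
    have := Finset.mem_range.1 hh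
    rw [mul_one, x_pow_mul_incl, mul_assoc, ← pow_add, ← AlgHom.mul_apply, ← pow_add]
    congr 5 <;> omega
  · intro s _ hne
    simp [coord_incl_mul, E.coord_x_pow _ hj, hne.symm]
  · intro h
    exact absurd (Finset.mem_range.2 hj) h

/-! ### The operator `D` -/

theorem sum_range_eq_sum_pairs {V : Type*} [AddCommMonoid V] (g : ℕ → V) {r : ℕ} (hr : r % 2 = 0) :
    ∑ q ∈ Finset.range r, g q = ∑ w ∈ Finset.range (r / 2), (g (2 * w) + g (2 * w + 1)) := by
  obtain ⟨m, rfl⟩ : ∃ m, r = 2 * m := ⟨r / 2, by omega⟩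
  rw [Nat.mul_div_cancel_left _ two_pos]
  clear hr
  induction m with
  | zero => simp
  | succ m ih =>
    rw [show 2 * (m + 1) = 2 * m + 1 + 1 by ring, Finset.sum_range_succ, Finset.sum_range_succ,
      Finset.sum_range_succ, ih, add_assoc]

theorem sum_rotVal_two_mul {r : ℕ} (hr : r % 2 = 0) {w : ℕ} (hw : w < r / 2) (j : ℕ) (c : K) :
    ∑ i ∈ Fintype.piFinset fun _ : Fin (r / 2) => Finset.Icc 1 E.n,
        ∑ l ∈ Fintype.piFinset fun t : Fin (r / 2) => Finset.Ico 1 (i t),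
          E.rotVal r l (2 * w) (E.phiHead r i l (E.incl c * E.x ^ j)) =
      E.cls (r + 1) (∑ i ∈ Finset.Icc 1 E.n, ∑ l ∈ Finset.Ico 1 i, ∑ h ∈ Finset.range l,
        E.incl (E.lam (E.n - i) * (E.α ^ (E.n * w + h)) c *
          E.coord (E.n - 1) (E.x ^ (j + (i - 1 - l)))) * E.x ^ (l - 1)) := by
  rw [sum_piFinset_eq_sum_update E.two_le ⟨w, hw⟩
    fun i l => E.rotVal r l (2 * w) (E.phiHead r i l (E.incl c * E.x ^ j))]
  · simp only [map_sum (E.cls (r + 1))]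
    refine Finset.sum_congr rfl fun i hi => Finset.sum_congr rfl fun l hl => ?_
    rw [Finset.mem_Ico] at hl
    rw [E.rotVal_of_even_two_mul hr hw, E.phiHead_update r _ hl.2, Function.update_self]
    · rw [← Finset.sum_range_reflect]
      refine Finset.sum_congr rfl fun h hh => ?_
      have hh := Finset.mem_range.1 hh
      rw [x_pow_mul_incl, mul_assoc, ← pow_add, ← AlgHom.mul_apply, ← pow_add,
        show l - (l - 1 - h) - 1 + E.n * w = E.n * w + h by omega,
        show l - (l - 1 - h) - 1 + (l - 1 - h) = l - 1 by omega,
        E.α_pow_coord _ _ _ (Nat.sub_le _ _), coord_incl_mul]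
    · intro t ht
      rw [Function.update_of_ne (fun h => ht (by rw [h]))]
  · rintro i l hil ⟨t, ht, hlt⟩
    have := hil t
    refine E.rotVal_eq_zero (by omega) _ t (by omega) fun _ => ?_
    rw [if_pos (by omega), Nat.mul_div_cancel_left _ two_pos]
    exact fun h => ht (Fin.ext h)

theorem sum_rotVal_two_mul_add_one {r : ℕ} (hr : r % 2 = 0) {w : ℕ} (hw : w < r / 2) (j : ℕ)
    (c : K) :
    ∑ i ∈ Fintype.piFinset fun _ : Fin (r / 2) => Finset.Icc 1 E.n,
        ∑ l ∈ Fintype.piFinset fun t : Fin (r / 2) => Finset.Ico 1 (i t),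
          E.rotVal r l (2 * w + 1) (E.phiHead r i l (E.incl c * E.x ^ j)) =
      E.cls (r + 1) (∑ i ∈ Finset.Icc 1 E.n, ∑ l ∈ Finset.Ico 1 i,
        E.incl (E.lam (E.n - i) * (E.α ^ (E.n * w + l)) c) *
          (E.quoX (j + (i - 1)) - E.quoX (j + (i - 1 - l)) * E.x ^ l)) := by
  rw [sum_piFinset_eq_sum_update E.two_le ⟨0, by omega⟩
    fun i l => E.rotVal r l (2 * w + 1) (E.phiHead r i l (E.incl c * E.x ^ j))]
  · simp only [map_sum (E.cls (r + 1))]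
    refine Finset.sum_congr rfl fun i hi => Finset.sum_congr rfl fun l hl => ?_
    rw [Finset.mem_Ico] at hl
    rw [E.rotVal_of_even_two_mul_add_one hr hw, E.phiHead_update r _ hl.2, Function.update_self]
    · simp only [E.α_pow_coord _ _ _ (Nat.sub_le _ _)]
      rw [sum_coord_monomial_mul_quoX, show j + (i - 1 - l) + l = j + (i - 1) by omega]
    · intro t ht
      rw [Function.update_of_ne (fun h => ht (by rw [h]))]
  · rintro i l hil ⟨t, ht, hlt⟩
    have := hil t
    refine E.rotVal_eq_zero (by omega) _ t (by omega) fun _ => ?_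
    rw [if_neg (by omega)]
    exact fun h => ht (Fin.ext h)

theorem D_cls_of_even {r : ℕ} (hr : r % 2 = 0) {j : ℕ} (hj : j < E.n) (c : K) :
    E.D r (E.cls r (E.incl c * E.x ^ j)) =
      E.cls (r + 1)
        (E.incl (∑ h ∈ Finset.range j, (E.α ^ (r / 2 * E.n + h)) c) * E.x ^ (j - 1)) +
      ∑ w ∈ Finset.range (r / 2), E.cls (r + 1) (E.toA (E.quo
        (∑ i ∈ Finset.Icc 1 E.n,
          E.C (E.lam (E.n - i) * ∑ l ∈ Finset.range i, (E.α ^ (E.n * w + l)) c) *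
            E.X ^ (j + i - 1)))) := by
  have hsign : ∀ q, (-1 : k) ^ (q * r) = 1 := fun q =>
    (Even.mul_left (Nat.even_iff.2 hr) q).neg_one_pow
  simp only [D_cls, hsign, one_smul]
  have hadd : ∀ a b a' b' : E.CS (r + 1), b = a' → a = b' → a + b = a' + b' := by
    rintro a b _ _ rfl rfl
    exact add_comm a b
  rw [Finset.sum_range_succ, sum_range_eq_sum_pairs _ hr]
  refine hadd _ _ _ _ ?_ ?_
  · rw [sum_piFinset_eq_single E.two_le
      fun i l => E.rotVal r l r (E.phiHead r i l (E.incl c * E.x ^ j))]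
    · rw [phiHead_const, E.rotVal_of_even_self hr (fun _ => rfl) hj]
    · rintro i l hil ⟨t, hlt⟩
      have := hil t
      refine E.rotVal_eq_zero le_rfl _ t (by omega) fun _ => ?_
      rw [if_pos hr]
      omega
  · refine Finset.sum_congr rfl fun w hw => ?_
    have hw := Finset.mem_range.1 hw
    rw [E.sum_rotVal_two_mul hr hw, E.sum_rotVal_two_mul_add_one hr hw, ← map_add,
      ← Finset.sum_add_distrib, quo_sum, map_sum E.toA]
    congr 1
    refine Finset.sum_congr rfl fun i hi => ?_
    have hi := Finset.mem_Icc.1 hi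
    rw [← Finset.sum_add_distrib,
      E.sum_quoX_telescope hj (fun h => E.lam (E.n - i) * (E.α ^ (E.n * w + h)) c) hi.1,
      quo_C_mul, map_mul, Finset.mul_sum, show j + i - 1 = j + (i - 1) by omega]
    rfl

theorem D_cls_of_odd {r : ℕ} (hr : r % 2 = 1) (a : E.A) :
    E.D r (E.cls r a) = ∑ w ∈ Finset.range ((r + 1) / 2), E.cls (r + 1)
      (E.incl ((E.α ^ (E.n * w)) (E.coord (E.n - 1) a) -
        E.α ((E.α ^ (E.n * w)) (E.coord (E.n - 1) a)))) := by
  have h : ∀ q ∈ Finset.range (r + 1), (-1 : k) ^ (q * r) •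
      ∑ i ∈ Fintype.piFinset fun _ : Fin (r / 2) => Finset.Icc 1 E.n,
        ∑ l ∈ Fintype.piFinset fun t : Fin (r / 2) => Finset.Ico 1 (i t),
          E.rotVal r l q (E.phiHead r i l a) = (-1 : k) ^ (q * r) •
      E.cls (r + 1) (E.incl ((E.α ^ (E.n * (q / 2) + q % 2)) (E.coord (E.n - 1) a))) := by
    intro q hq
    have hq : q ≤ r := by have := Finset.mem_range.1 hq; omega
    rw [sum_piFinset_eq_single E.two_le fun i l => E.rotVal r l q (E.phiHead r i l a)]
    · rw [phiHead_const, E.rotVal_of_odd hr (fun _ => rfl) hq]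
    · rintro i l hil ⟨t, hlt⟩
      have := hil t
      exact E.rotVal_eq_zero hq _ t (by omega) fun _ => by omega
  rw [D_cls, Finset.sum_congr rfl h, sum_range_eq_sum_pairs _ (by omega)]
  refine Finset.sum_congr rfl fun w _ => ?_
  have h0 : (-1 : k) ^ (2 * w * r) = 1 := Even.neg_one_pow (by simp [mul_assoc])
  have h1 : (-1 : k) ^ ((2 * w + 1) * r) = -1 :=
    Odd.neg_one_pow (Odd.mul (odd_two_mul_add_one w) (Nat.odd_iff.2 hr))
  rw [h0, h1, show 2 * w / 2 = w by omega, show 2 * w % 2 = 0 by omega,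
    show (2 * w + 1) / 2 = w by omega, show (2 * w + 1) % 2 = 1 by omega, one_smul, neg_one_smul,
    ← sub_eq_add_neg, ← map_sub, ← map_sub, add_zero, ← AlgHom.mul_apply, ← pow_succ']

end MonogenicDatum

end

theorem theorem3p3 {k : Type*} {K : Type*} [CommRing k] [Ring K] [Algebra k K]
    (E : MonogenicDatum k K) (m j : ℕ) (hj : j < E.n) (c : K) :
    E.D (2 * m) (E.cls (2 * m) (E.incl c * E.x ^ j)) =
        E.cls (2 * m + 1)
          (E.incl (∑ h ∈ Finset.range j, (E.α ^ (m * E.n + h)) c) * E.x ^ (j - 1)) +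
        ∑ u ∈ Finset.range m, E.cls (2 * m + 1) (E.toA (E.quo
          (∑ i ∈ Finset.Icc 1 E.n,
            E.C (E.lam (E.n - i) * ∑ l ∈ Finset.range i, (E.α ^ (E.n * u + l)) c) *
              E.X ^ (j + i - 1)))) ∧
    E.D (2 * m + 1) (E.cls (2 * m + 1) (E.incl c * E.x ^ j)) =
      if j < E.n - 1 then 0 else
        E.cls (2 * m + 2) (E.incl
          ((∑ u ∈ Finset.range (m + 1), (E.α ^ (E.n * u)) c) -
            E.α (∑ u ∈ Finset.range (m + 1), (E.α ^ (E.n * u)) c))) := by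
  constructor
  · have h := E.D_cls_of_even (r := 2 * m) (by omega) hj c
    rwa [Nat.mul_div_cancel_left _ two_pos] at h
  · rw [E.D_cls_of_odd (by omega), show (2 * m + 1 + 1) / 2 = m + 1 by omega, E.coord_incl_mul,
      E.coord_x_pow _ hj]
    rcases eq_or_ne j (E.n - 1) with h | h
    · rw [if_pos h, if_neg h.not_lt, mul_one, ← map_sum, ← map_sum, Finset.sum_sub_distrib,
        map_sum E.α]
    · rw [if_neg h, if_pos (by omega)]
      simp
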